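/- Let $\gamma_d(dx)=\pi^{-d/2}e^{-|x|^2}dx$ on $\mathbb R^d$. For $t>0$ let $$T_tf(x)=\frac1{(1-e^{-2t})^{d/2}}\int_{\mathbb R^d}\exp\Big(-\frac{e^{-2t}(|x|^2+|y|^2)-2e^{-t}\langle x,y\rangle}{1-e^{-2t}}\Big)f(y)\,\gamma_d(dy),\qquad P_tf(x)=\frac1{\sqrt\pi}\int_0^\infty\frac{e^{-u}}{\sqrt u}\,T_{t^2/(4u)}f(x)\,du$$ be the Ornstein–Uhlenbeck and Poisson–Hermite semigroups. Let $p(\cdot):\mathbb R^d\to[1,\infty)$ be a measurable function such that * (class $\mathcal P^\infty_{\gamma_d}$) there are $C>0$ and $p_\infty\ge 1$ with $|p(x)-p_\infty|\le C/|x|^2$ for all $x\ne 0$, and * (class $LH_0$) there is $C_1>0$ with $|p(x)-p(y)|\le C_1/\log(e+1/|x-y|)$ for all $x\neq y$. Let $L^{p(\cdot)}(\gamma_d)$ be the space of measurable $f$ with $\int|f(x)/\lambda|^{p(x)}\gamma_d(dx)<\infty$ for some $\lambda>0$, and put $\|f\|_{p(\cdot),\gamma_d}=\inf\{\lambda>0:\int|f(x)/\lambda|^{p(x)}\gamma_d(dx)\le1\}$.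 Let $\alpha\ge0$ and let $k,l$ be integers greater than $\alpha$. Then for every $f\in L^{p(\cdot)}(\gamma_d)$: there is a constant $A_k\ge 0$ with $\big\|\frac{\partial^k}{\partial t^k}P_tf\big\|_{p(\cdot),\gamma_d}\le A_kt^{-k+\alpha}$ for all $t>0$ if and only if there is a constant $A_l\ge 0$ with $\big\|\frac{\partial^l}{\partial t^l}P_tf\big\|_{p(\cdot),\gamma_d}\le A_lt^{-l+\alpha}$ for all $t>0$. In that case the smallest such constants $A_k(f)$ and $A_l(f)$ exist, and $$c\,A_k(f)\le A_l(f)\le C'A_k(f)$$ with constants $c,C'>0$ that depend only on $k,l,\alpha,d$ and $p(\cdot)$, not on $f$. If moreover $l\le k$, then $A_l(f)\le D\,A_k(f)$ with a constant $D>0$ that depends only on $k,l,\alpha$. Consequently the space $B^\alpha_{p(\cdot),\infty}(\gamma_d)$, defined as the set of $f\in L^{p(\cdot)}(\gamma_d)$ for which there is $A\ge 0$ with $\big\|\frac{\partial^m}{\partial t^m}P_tf\big\|_{p(\cdot),\gamma_d}\le At^{-m+\alpha}$ for all $t>0$, where $m$ is the smallest integer greater than $\alpha$, does not change when $m$ is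 replaced by $k$ or by $l$. -/

import Mathlib

open MeasureTheory
open scoped NNReal ENNReal

noncomputable section

namespace GaussianBesov

/-- The space `ℝ^d` with its Euclidean norm and inner product. -/
abbrev Space (d : ℕ) : Type := EuclideanSpace ℝ (Fin d)

/-- The Gaussian measure `γ_d(dx) = π^{-d/2} e^{-|x|²} dx`. -/
def gaussian (d : ℕ) : Measure (Space d) :=
  (volume : Measure (Space d)).withDensity
    fun x => ENNReal.ofReal (Real.exp (-‖x‖ ^ 2) / Real.pi ^ ((d : ℝ) / 2))

/-- The Ornstein-Uhlenbeck semigroup, for `t > 0`. -/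
def ornsteinUhlenbeck {d : ℕ} (t : ℝ) (f : Space d → ℝ) (x : Space d) : ℝ :=
  1 / (1 - Real.exp (-2 * t)) ^ ((d : ℝ) / 2) *
    ∫ y, Real.exp (-((Real.exp (-2 * t) * (‖x‖ ^ 2 + ‖y‖ ^ 2)
        - 2 * Real.exp (-t) * inner ℝ x y) / (1 - Real.exp (-2 * t)))) * f y ∂(gaussian d)

/-- The Poisson-Hermite semigroup, for `t > 0`:
`P_t f(x) = π^{-1/2} ∫_0^∞ e^{-u} u^{-1/2} T_{t²/4u} f(x) du`. -/
def poissonHermite {d : ℕ} (t : ℝ) (f : Space d → ℝ) (x : Space d) : ℝ :=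
  1 / Real.sqrt Real.pi *
    ∫ u in Set.Ioi (0 : ℝ),
      Real.exp (-u) / Real.sqrt u * ornsteinUhlenbeck (t ^ 2 / (4 * u)) f x

/-- `∂^k P_t f(x) / ∂t^k`, as a function of `x`. -/
def poissonDeriv {d : ℕ} (k : ℕ) (t : ℝ) (f : Space d → ℝ) (x : Space d) : ℝ :=
  iteratedDeriv k (fun s => poissonHermite s f x) t

/-- Exponent functions on `ℝ^d` for the measure `γ_d`, with finite values (the value `∞` is
excluded by local log-Hölder continuity). -/
structure IsExponent {d : ℕ} (p : Space d → ℝ) : Prop where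
  aemeasurable : AEMeasurable p (gaussian d)
  one_le : ∀ x, 1 ≤ p x

/-- The class `LH_0(ℝ^d)` of locally log-Hölder continuous functions. -/
def LocallyLogHolder {d : ℕ} (p : Space d → ℝ) : Prop :=
  ∃ C : ℝ, 0 < C ∧ ∀ x y, |p x - p y| ≤ C / Real.log (Real.exp 1 + 1 / ‖x - y‖)

/-- The class `P^∞_{γ_d}(ℝ^d)` of exponents. -/
def GaussianDecay {d : ℕ} (p : Space d → ℝ) : Prop :=
  IsExponent p ∧ ∃ C pinf : ℝ, 0 < C ∧ 1 ≤ pinf ∧ ∀ x, x ≠ 0 → |p x - pinf| ≤ C / ‖x‖ ^ 2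

/-- The modular `∫ |f(x)|^{p(x)} γ_d(dx)`, for an exponent with finite values. -/
def modular {d : ℕ} (p : Space d → ℝ) (f : Space d → ℝ) : ℝ≥0∞ :=
  ∫⁻ x, ENNReal.ofReal (|f x| ^ p x) ∂(gaussian d)

/-- The Luxemburg norm `‖f‖_{p(·),γ_d}`, equal to `∞` when no `λ` is admissible. -/
def luxemburgNorm {d : ℕ} (p : Space d → ℝ) (f : Space d → ℝ) : ℝ≥0∞ :=
  sInf {r : ℝ≥0∞ | ∃ s : ℝ, 0 < s ∧ r = ENNReal.ofReal s ∧ modular p (fun x => f x / s) ≤ 1}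

/-- Membership in the variable Lebesgue space `L^{p(·)}(γ_d)`. -/
def MemVarLp {d : ℕ} (p : Space d → ℝ) (f : Space d → ℝ) : Prop :=
  AEMeasurable f (gaussian d) ∧ ∃ s : ℝ, 0 < s ∧ modular p (fun x => f x / s) < ∞

/-- The constants `A ≥ 0` such that `‖∂_t^k P_t f‖_{p(·),γ_d} ≤ A t^{-k+α}` for all `t > 0`. -/
def admissibleConstants {d : ℕ} (p : Space d → ℝ) (α : ℝ) (k : ℕ) (f : Space d → ℝ) :
    Set ℝ≥0 :=
  {A | ∀ t : ℝ, 0 < t →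
    luxemburgNorm p (poissonDeriv k t f) ≤ (A : ℝ≥0∞) * ENNReal.ofReal (t ^ (-(k : ℝ) + α))}

/-- The functions of `L^{p(·)}(γ_d)` that satisfy a bound of order `k`. -/
def besovInftyOfOrder {d : ℕ} (p : Space d → ℝ) (α : ℝ) (k : ℕ) : Set (Space d → ℝ) :=
  {f | MemVarLp p f ∧ (admissibleConstants p α k f).Nonempty}

/-- The variable Gaussian Besov-Lipschitz space `B^α_{p(·),∞}(γ_d)`, for `α ≥ 0`: here
`⌊α⌋₊ + 1` is the smallest integer greater than `α`. -/
def besovInfty {d : ℕ} (p : Space d → ℝ) (α : ℝ) : Set (Space d → ℝ) :=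
  besovInftyOfOrder p α (⌊α⌋₊ + 1)

end GaussianBesov

end

/-!
The bounds of orders `k` and `l` are compared in both directions through the subordination formula
`P_t f = ∫_0^∞ φ_t(s) T_s f ds`, where `φ_t` is the one-sided stable density of index `1/2`
(`levy`). All derivatives in `t` fall on `φ_t`, and scaling gives `|∂_t^k φ_t| ≤ C_k t^{-k} φ_{t/2}`
(`exists_abs_levy_le`). Hence `|∂_t^k P_t f| ≤ C_k t^{-k} P_{t/2} |f|` pointwise.

*Lowering the order* (`admissible_of_succ`). For `n ≥ 1` the derivative `∂_t^n P_t f` vanishes at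
infinity, so it equals `-∫_t^∞ ∂_s^{n+1} P_s f ds`, and the integral Minkowski inequality for the
Luxemburg norm turns a bound `A s^{-n-1+α}` into `A / (n - α) · t^{-n+α}`. Jensen's inequality for
the modular gives the Minkowski inequality with constant one, so the factor depends neither on the
exponent nor on the dimension.

*Raising the order* (`exists_admissible_add`). The semigroup property gives
`∂_t^{j+k} P_t f = ∂_a^j P_a g` at `a = t/2`, with `g = ∂_t^k P_{t/2} f`. It remains to know that
`P_t` is bounded on `L^{p(·)}(γ_d)` uniformly in `t`. By Jensen's inequality it is enough to bound
`T_s` (`exists_lintegral_ou_rpow_le`). Let `∫ |f|^{p(·)} dγ_d ≤ 1`, let `K` be the Mehler kernel,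
and let `l` be the larger of `1` and `∫ K(x, y) |f(y)|^{p(y)} γ_d(dy)`. Comparing `|f(y)|` with
`l^{1/p(x)}` gives
`|f(y)| ≤ l^{1/p(x)} (1 + l^{(p(x) - p(y))/p(x)} |f(y)|^{p(y)} / l)`,
and after integration `(T_s |f|(x))^{p(x)} ≤ C l`, which is integrable, as soon as
`l^{p(x) - p(y)}` is bounded. Since `l` is at most `B = (1 - e^{-2s})^{-d/2} e^{|x|²}`, the decay of
`p` at infinity and its log-Hölder continuity bound `l^{p(x) - p(y)}` for all pairs `(x, y)` except
those where `K(x, y) ≤ C e^{|x|²/(2 sup p)}`; these contribute an integrable error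
(`exists_mehler_dichotomy`). No maximal function is involved, so exponents that take the value `1`
are covered.

The semigroup property itself comes from the Chapman-Kolmogorov identity for the Mehler kernel
(`lintegral_mehler_mul_mehler`) and from `φ_a * φ_b = φ_{a+b}` (`lintegral_levy_mul_levy`).
-/

noncomputable section

namespace GaussianBesov

/-! ### The Gaussian measure and the Mehler kernel -/

lemma measurable_gaussianDensity (d : ℕ) : Measurable fun x : Space d =>
    ENNReal.ofReal (Real.exp (-‖x‖ ^ 2) / Real.pi ^ ((d : ℝ) / 2)) := by
  fun_prop

lemma integrable_exp_quadratic {d : ℕ} {b : ℝ} (hb : 0 < b) (w : Space d) :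
    Integrable (fun y : Space d => Real.exp (-b * ‖y‖ ^ 2 + inner ℝ w y)) := by
  have h := (GaussianFourier.integrable_cexp_neg_mul_sq_norm_add (V := Space d)
    (b := (b : ℂ)) (by simpa using hb) 1 w).re
  refine h.congr (Filter.Eventually.of_forall fun y => ?_)
  have e : (-(b : ℂ) * ((‖y‖ : ℝ) : ℂ) ^ 2 + 1 * ((inner ℝ w y : ℝ) : ℂ))
      = ((-b * ‖y‖ ^ 2 + inner ℝ w y : ℝ) : ℂ) := by push_cast; ring
  change (Complex.exp _).re = Real.exp _
  rw [e, Complex.exp_ofReal_re]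

lemma integral_exp_quadratic {d : ℕ} {b : ℝ} (hb : 0 < b) (w : Space d) :
    ∫ y : Space d, Real.exp (-b * ‖y‖ ^ 2 + inner ℝ w y)
      = (Real.pi / b) ^ ((d : ℝ) / 2) * Real.exp (‖w‖ ^ 2 / (4 * b)) := by
  have h := GaussianFourier.integral_cexp_neg_mul_sq_norm_add (V := Space d)
    (b := (b : ℂ)) (by simpa using hb) 1 w
  apply Complex.ofReal_injective
  rw [← integral_complex_ofReal]
  convert h using 1
  · congr 1; ext y; push_cast; simp
  · rw [Complex.ofReal_mul, Complex.ofReal_cpow (by positivity)]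
    push_cast
    simp

/-- The Laplace transform of a Gaussian, tested against `γ_d`. -/
lemma lintegral_exp_quadratic_gaussian {d : ℕ} {c : ℝ} (hc : 0 < 1 + c) (w : Space d) :
    ∫⁻ y, ENNReal.ofReal (Real.exp (-c * ‖y‖ ^ 2 + inner ℝ w y)) ∂(gaussian d)
      = ENNReal.ofReal ((1 / (1 + c)) ^ ((d : ℝ) / 2)
          * Real.exp (‖w‖ ^ 2 / (4 * (1 + c)))) := by
  have hpi : 0 < Real.pi ^ ((d : ℝ) / 2) := by positivity
  have e : ∀ y : Space d,
      Real.exp (-‖y‖ ^ 2) / Real.pi ^ ((d : ℝ) / 2) * Real.exp (-c * ‖y‖ ^ 2 + inner ℝ w y)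
      = (Real.pi ^ ((d : ℝ) / 2))⁻¹ * Real.exp (-(1 + c) * ‖y‖ ^ 2 + inner ℝ w y) := by
    intro y
    rw [div_mul_eq_mul_div, ← Real.exp_add, div_eq_inv_mul]
    congr 2
    ring
  rw [gaussian, lintegral_withDensity_eq_lintegral_mul _ (measurable_gaussianDensity d)
    (by fun_prop)]
  simp only [Pi.mul_apply]
  have e2 : ∀ y : Space d, ENNReal.ofReal (Real.exp (-‖y‖ ^ 2) / Real.pi ^ ((d : ℝ) / 2)) *
      ENNReal.ofReal (Real.exp (-c * ‖y‖ ^ 2 + inner ℝ w y))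
      = ENNReal.ofReal ((Real.pi ^ ((d : ℝ) / 2))⁻¹ *
        Real.exp (-(1 + c) * ‖y‖ ^ 2 + inner ℝ w y)) := by
    intro y
    rw [← ENNReal.ofReal_mul (by positivity), e]
  simp_rw [e2]
  rw [← ofReal_integral_eq_lintegral_ofReal ((integrable_exp_quadratic hc w).const_mul _)
    (Filter.Eventually.of_forall fun y => by positivity), integral_const_mul,
    integral_exp_quadratic hc w]
  congr 1
  rw [Real.div_rpow Real.pi_pos.le hc.le, Real.div_rpow one_pos.le hc.le, Real.one_rpow]
  field_simp

instance isProbabilityMeasure_gaussian (d : ℕ) : IsProbabilityMeasure (gaussian d) := by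
  constructor
  have h := lintegral_exp_quadratic_gaussian (d := d) (c := 0) (by norm_num) 0
  simpa using h

/-- The Mehler kernel: the density with respect to `γ_d` of the Ornstein-Uhlenbeck transition
probabilities. -/
def mehler {d : ℕ} (t : ℝ) (x y : Space d) : ℝ :=
  1 / (1 - Real.exp (-2 * t)) ^ ((d : ℝ) / 2) *
    Real.exp (-((Real.exp (-2 * t) * (‖x‖ ^ 2 + ‖y‖ ^ 2)
        - 2 * Real.exp (-t) * inner ℝ x y) / (1 - Real.exp (-2 * t))))

/-- The variance factor `1 - e^{-2t}` of the Ornstein-Uhlenbeck transition probabilities. -/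
def ouVar (t : ℝ) : ℝ := 1 - Real.exp (-2 * t)

lemma ouVar_pos {t : ℝ} (ht : 0 < t) : 0 < ouVar t := by
  have : Real.exp (-2 * t) < 1 := Real.exp_lt_one_iff.mpr (by linarith)
  unfold ouVar; linarith

lemma ouVar_lt_one (t : ℝ) : ouVar t < 1 := by
  have := Real.exp_pos (-2 * t)
  unfold ouVar; linarith

lemma exp_neg_sq_eq (t : ℝ) : Real.exp (-t) ^ 2 = 1 - ouVar t := by
  rw [ouVar, ← Real.exp_nat_mul]; push_cast; ring_nf

lemma exp_neg_two_mul_eq (t : ℝ) : Real.exp (-2 * t) = 1 - ouVar t := by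
  rw [ouVar]; ring

lemma mehler_eq {d : ℕ} {t : ℝ} (x y : Space d) :
    mehler t x y = 1 / ouVar t ^ ((d : ℝ) / 2) *
      Real.exp (-((Real.exp (-t) ^ 2 * (‖x‖ ^ 2 + ‖y‖ ^ 2)
        - 2 * Real.exp (-t) * inner ℝ x y) / ouVar t)) := by
  rw [mehler, exp_neg_sq_eq, exp_neg_two_mul_eq]
  simp

lemma mehler_comm {d : ℕ} (t : ℝ) (x y : Space d) : mehler t x y = mehler t y x := by
  simp only [mehler, add_comm (‖x‖ ^ 2), real_inner_comm]

lemma mehler_pos {d : ℕ} {t : ℝ} (ht : 0 < t) (x y : Space d) : 0 < mehler t x y := by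
  have := ouVar_pos ht
  rw [mehler_eq]; positivity

lemma mehler_eq_exp_sub {d : ℕ} {t : ℝ} (ht : 0 < t) (x y : Space d) :
    mehler t x y = 1 / ouVar t ^ ((d : ℝ) / 2) *
      Real.exp (‖x‖ ^ 2 - ‖x - Real.exp (-t) • y‖ ^ 2 / ouVar t) := by
  have h := (ouVar_pos ht).ne'
  rw [mehler_eq, norm_sub_sq_real, norm_smul, inner_smul_right, mul_pow, Real.norm_eq_abs, sq_abs,
    exp_neg_sq_eq]
  congr 2
  field_simp
  ring

lemma mehler_le {d : ℕ} {t : ℝ} (ht : 0 < t) (x y : Space d) :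
    mehler t x y ≤ 1 / ouVar t ^ ((d : ℝ) / 2) * Real.exp (‖x‖ ^ 2) := by
  have := ouVar_pos ht
  rw [mehler_eq_exp_sub ht]
  gcongr
  have : 0 ≤ ‖x - Real.exp (-t) • y‖ ^ 2 / ouVar t := by positivity
  linarith

lemma measurable_mehler {d : ℕ} {Ω : Type*} [MeasurableSpace Ω] {s : Ω → ℝ}
    {x y : Ω → Space d} (hs : Measurable s) (hx : Measurable x) (hy : Measurable y) :
    Measurable fun ω => mehler (s ω) (x ω) (y ω) := by
  unfold mehler; fun_prop

lemma lintegral_mehler {d : ℕ} {t : ℝ} (ht : 0 < t) (x : Space d) :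
    ∫⁻ y, ENNReal.ofReal (mehler t x y) ∂(gaussian d) = 1 := by
  have hr := ouVar_pos ht
  set q := Real.exp (-t) with hq
  have hq2 : q ^ 2 = 1 - ouVar t := exp_neg_sq_eq t
  set r := ouVar t with hrd
  have e : ∀ y : Space d, mehler t x y =
      1 / r ^ ((d : ℝ) / 2) * Real.exp (-(q ^ 2 * ‖x‖ ^ 2 / r)) *
      Real.exp (-(q ^ 2 / r) * ‖y‖ ^ 2 + inner ℝ ((2 * q / r) • x) y) := by
    intro y
    rw [mehler_eq, inner_smul_left, mul_assoc (1 / _), ← Real.exp_add]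
    congr 2
    simp only [conj_trivial]
    ring
  have h1 : (1 : ℝ) + q ^ 2 / r = 1 / r := by rw [hq2]; field_simp; ring
  simp_rw [e]
  simp_rw [ENNReal.ofReal_mul (show 0 ≤ 1 / r ^ ((d : ℝ) / 2) * Real.exp (-(q ^ 2 * ‖x‖ ^ 2 / r))
    by positivity)]
  rw [lintegral_const_mul _ (by fun_prop),
    lintegral_exp_quadratic_gaussian (by rw [h1]; positivity), h1,
    ← ENNReal.ofReal_mul (by positivity), ← ENNReal.ofReal_one]
  congr 1
  rw [one_div_one_div, norm_smul, mul_pow, Real.norm_eq_abs, sq_abs]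
  have : (2 * q / r) ^ 2 * ‖x‖ ^ 2 / (4 * (1 / r)) = q ^ 2 * ‖x‖ ^ 2 / r := by
    field_simp; ring
  rw [this, show ∀ A B C D : ℝ, A * B * (C * D) = A * C * (B * D) by intros; ring,
    ← Real.exp_add]
  have : r ^ ((d : ℝ) / 2) ≠ 0 := by positivity
  simp [this]

/-- The Chapman-Kolmogorov identity for the Mehler kernel. -/
lemma lintegral_mehler_mul_mehler {d : ℕ} {a b : ℝ} (ha : 0 < a) (hb : 0 < b) (x z : Space d) :
    ∫⁻ y, ENNReal.ofReal (mehler a x y) * ENNReal.ofReal (mehler b y z) ∂(gaussian d)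
      = ENNReal.ofReal (mehler (a + b) x z) := by
  have hr := ouVar_pos ha
  have hs := ouVar_pos hb
  have hab := ouVar_pos (add_pos ha hb)
  have hq2 : Real.exp (-a) ^ 2 = 1 - ouVar a := exp_neg_sq_eq a
  have hp2 : Real.exp (-b) ^ 2 = 1 - ouVar b := exp_neg_sq_eq b
  have hqp : Real.exp (-(a + b)) = Real.exp (-a) * Real.exp (-b) := by
    rw [← Real.exp_add]; congr 1; ring
  have hm : ouVar (a + b) = ouVar a + ouVar b - ouVar a * ouVar b := by
    have := exp_neg_sq_eq (a + b)
    rw [hqp, mul_pow, hq2, hp2] at this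
    linear_combination this
  set q := Real.exp (-a) with hq
  set p := Real.exp (-b) with hp
  set r := ouVar a with hrd
  set s := ouVar b with hsd
  set m := ouVar (a + b) with hmd
  have e : ∀ y : Space d, ENNReal.ofReal (mehler a x y) * ENNReal.ofReal (mehler b y z) =
      ENNReal.ofReal (1 / r ^ ((d : ℝ) / 2) * (1 / s ^ ((d : ℝ) / 2)) *
        Real.exp (-(q ^ 2 * ‖x‖ ^ 2 / r) - p ^ 2 * ‖z‖ ^ 2 / s)) *
      ENNReal.ofReal (Real.exp (-(q ^ 2 / r + p ^ 2 / s) * ‖y‖ ^ 2 +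
        inner ℝ ((2 * q / r) • x + (2 * p / s) • z) y)) := by
    intro y
    rw [← ENNReal.ofReal_mul (mehler_pos ha _ _).le, ← ENNReal.ofReal_mul (by positivity),
      mehler_eq, mehler_eq, inner_add_left, inner_smul_left, inner_smul_left]
    congr 1
    rw [mul_mul_mul_comm, ← Real.exp_add, mul_assoc (_ * _) (Real.exp _), ← Real.exp_add]
    congr 2
    simp only [conj_trivial]
    rw [real_inner_comm y z]
    ring
  have h1 : (1 : ℝ) + (q ^ 2 / r + p ^ 2 / s) = m / (r * s) := by
    rw [hq2, hp2, hm]; field_simp; ring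
  simp_rw [e]
  rw [lintegral_const_mul _ (by fun_prop),
    lintegral_exp_quadratic_gaussian (by rw [h1]; positivity), h1,
    ← ENNReal.ofReal_mul (by positivity)]
  congr 1
  rw [mehler_eq, hqp, ← hmd, mul_mul_mul_comm, ← Real.exp_add]
  congr 1
  · rw [one_div_div, Real.div_rpow (by positivity) (by positivity),
      Real.mul_rpow (by positivity) (by positivity)]
    have : r ^ ((d : ℝ) / 2) ≠ 0 := by positivity
    have : s ^ ((d : ℝ) / 2) ≠ 0 := by positivity
    field_simp
  · congr 1
    rw [norm_add_sq_real, norm_smul, norm_smul, mul_pow, mul_pow, Real.norm_eq_abs,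
      Real.norm_eq_abs, sq_abs, sq_abs, inner_smul_left, inner_smul_right]
    simp only [conj_trivial]
    rw [mul_pow q p, hq2, hp2]
    generalize inner ℝ x z = X
    generalize ‖x‖ ^ 2 = N
    generalize ‖z‖ ^ 2 = Z
    have e1 : (2 * q / r) ^ 2 = 4 * (1 - r) / r ^ 2 := by rw [div_pow, mul_pow, hq2]; norm_num
    have e2 : (2 * p / s) ^ 2 = 4 * (1 - s) / s ^ 2 := by rw [div_pow, mul_pow, hp2]; norm_num
    rw [e1, e2]
    have hm0 := hab.ne'
    field_simp
    rw [hm]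
    ring

/-! ### The one-sided stable density and its derivatives -/

/-- The polynomial `Q_k` such that `Q_k(v) e^{-v²/4}` is the `k`-th derivative of
`v ↦ v e^{-v²/4}`. -/
def levyPoly : ℕ → Polynomial ℝ
  | 0 => Polynomial.X
  | k + 1 => Polynomial.derivative (levyPoly k) -
      Polynomial.C (1 / 2) * Polynomial.X * levyPoly k

/-- The `k`-th derivative in `t` of the one-sided stable density of index `1/2`,
`φ_t(s) = t / (2 √π s^{3/2}) e^{-t²/4s}` for `s > 0`. The scaling `φ_t(s) = s⁻¹ Φ(t/√s)` is used
as the definition. -/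
def levy (k : ℕ) (t s : ℝ) : ℝ :=
  (2 * Real.sqrt Real.pi * s)⁻¹ * (Real.sqrt s)⁻¹ ^ k * (levyPoly k).eval (t / Real.sqrt s) *
    Real.exp (-(t / Real.sqrt s) ^ 2 / 4)

lemma hasDerivAt_levyPoly (k : ℕ) (v : ℝ) :
    HasDerivAt (fun v => (levyPoly k).eval v * Real.exp (-v ^ 2 / 4))
      ((levyPoly (k + 1)).eval v * Real.exp (-v ^ 2 / 4)) v := by
  have h1 := (levyPoly k).hasDerivAt v
  have h2 : HasDerivAt (fun v : ℝ => Real.exp (-v ^ 2 / 4))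
      (Real.exp (-v ^ 2 / 4) * (-(2 * v) / 4)) v := by
    have := (((hasDerivAt_pow 2 v).neg).div_const 4).exp
    simpa using this
  refine (h1.mul h2).congr_deriv ?_
  simp only [levyPoly, Polynomial.eval_sub, Polynomial.eval_mul, Polynomial.eval_C,
    Polynomial.eval_X]
  ring

lemma hasDerivAt_levy (k : ℕ) (t s : ℝ) :
    HasDerivAt (fun t => levy k t s) (levy (k + 1) t s) t := by
  have h := (hasDerivAt_levyPoly k (t / Real.sqrt s)).comp t
    ((hasDerivAt_id t).div_const (Real.sqrt s))
  have := h.const_mul ((2 * Real.sqrt Real.pi * s)⁻¹ * (Real.sqrt s)⁻¹ ^ k)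
  refine (this.congr_deriv ?_).congr_of_eventuallyEq (Filter.Eventually.of_forall fun t => ?_)
  · simp only [levy, pow_succ, one_div]
    ring
  · simp [levy, mul_assoc]

lemma levy_zero_eq (t s : ℝ) (hs : 0 < s) :
    levy 0 t s = t / (2 * Real.sqrt Real.pi * s * Real.sqrt s) * Real.exp (-(t ^ 2 / (4 * s))) := by
  simp only [levy, levyPoly, Polynomial.eval_X, pow_zero, mul_one, div_pow, Real.sq_sqrt hs.le]
  have : Real.sqrt s ≠ 0 := by positivity
  have e : -(t ^ 2 / s) / 4 = -(t ^ 2 / (4 * s)) := by field_simp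
  rw [e]
  field_simp

lemma levy_zero_pos {t s : ℝ} (ht : 0 < t) (hs : 0 < s) : 0 < levy 0 t s := by
  rw [levy_zero_eq t s hs]; positivity

@[fun_prop]
lemma measurable_levy {Ω : Type*} [MeasurableSpace Ω] (k : ℕ) {t s : Ω → ℝ} (ht : Measurable t)
    (hs : Measurable s) : Measurable fun ω => levy k (t ω) (s ω) := by
  unfold levy
  have h : Measurable fun ω => (levyPoly k).eval (t ω / Real.sqrt (s ω)) :=
    (levyPoly k).continuous.measurable.comp (by fun_prop)
  fun_prop

lemma exists_abs_eval_le_exp (R : Polynomial ℝ) {c : ℝ} (hc : 0 < c) :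
    ∃ C, 0 < C ∧ ∀ v : ℝ, |R.eval v| ≤ C * Real.exp (c * v ^ 2) := by
  induction R using Polynomial.induction_on' with
  | add p q hp hq =>
    obtain ⟨C, hC, h⟩ := hp
    obtain ⟨D, hD, h'⟩ := hq
    refine ⟨C + D, by positivity, fun v => ?_⟩
    rw [Polynomial.eval_add, add_mul]
    exact (abs_add_le _ _).trans (add_le_add (h v) (h' v))
  | monomial n a =>
    refine ⟨(|a| + 1) * (1 + n.factorial / c ^ n), by positivity, fun v => ?_⟩
    rw [Polynomial.eval_monomial, abs_mul, mul_assoc]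
    have h1 : |v ^ n| ≤ 1 + (v ^ 2) ^ n := by
      have : (v ^ 2) ^ n = |v ^ n| ^ 2 := by rw [sq_abs]; ring
      rw [this]
      nlinarith [sq_nonneg (|v ^ n| - 1), abs_nonneg (v ^ n)]
    have h2 := Real.pow_div_factorial_le_exp (c * v ^ 2) (by positivity) n
    have h3 : (v ^ 2) ^ n ≤ n.factorial / c ^ n * Real.exp (c * v ^ 2) := by
      rw [mul_pow, div_le_iff₀ (by positivity)] at h2
      rw [div_mul_eq_mul_div, le_div_iff₀ (by positivity)]
      linarith
    have h4 : 1 ≤ Real.exp (c * v ^ 2) := Real.one_le_exp (by positivity)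
    have h5 : |v ^ n| ≤ (1 + n.factorial / c ^ n) * Real.exp (c * v ^ 2) := by
      rw [add_mul]; linarith
    gcongr
    linarith

/-- Derivatives of the stable density are dominated by the density at a smaller time. -/
lemma exists_abs_levy_le (k : ℕ) : ∃ C, 0 < C ∧ ∀ t s : ℝ, 0 < t → 0 < s →
    |levy k t s| ≤ C / t ^ k * levy 0 (t / 2) s := by
  -- The factor `v` of `v e^{-v²/4}` has to survive in the bound, hence the division by `X`.
  obtain ⟨R, hR⟩ : ∃ R : Polynomial ℝ, Polynomial.X ^ k * levyPoly k = Polynomial.X * R := by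
    cases k with
    | zero => exact ⟨1, by simp [levyPoly]⟩
    | succ k => exact ⟨Polynomial.X ^ k * levyPoly (k + 1), by ring⟩
  obtain ⟨C, hC, h⟩ := exists_abs_eval_le_exp R (c := 3 / 16) (by norm_num)
  refine ⟨2 * C, by positivity, fun t s ht hs => ?_⟩
  have hv : 0 < t / Real.sqrt s := by positivity
  have e1 : t / 2 / Real.sqrt s = t / Real.sqrt s / 2 := by ring
  have e2 : (Real.sqrt s)⁻¹ ^ k = (t / Real.sqrt s) ^ k / t ^ k := by
    rw [div_pow, inv_pow]; field_simp
  simp only [levy, e1, e2]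
  set v := t / Real.sqrt s with hvd
  have hR' : v ^ k * (levyPoly k).eval v = v * R.eval v := by
    simpa using congrArg (Polynomial.eval v) hR
  have hA : 0 < (2 * Real.sqrt Real.pi * s)⁻¹ := by positivity
  set A := (2 * Real.sqrt Real.pi * s)⁻¹
  have hexp : Real.exp (3 / 16 * v ^ 2) * Real.exp (-v ^ 2 / 4) = Real.exp (-(v / 2) ^ 2 / 4) := by
    rw [← Real.exp_add]; congr 1; ring
  calc |A * (v ^ k / t ^ k) * (levyPoly k).eval v * Real.exp (-v ^ 2 / 4)|
      = |A / t ^ k * (v ^ k * (levyPoly k).eval v) * Real.exp (-v ^ 2 / 4)| := by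
        congr 1; ring
    _ = A / t ^ k * (v * |R.eval v|) * Real.exp (-v ^ 2 / 4) := by
        rw [hR', abs_mul, abs_mul, abs_mul, abs_of_pos hv, abs_of_pos (Real.exp_pos _),
          abs_of_pos (by positivity : 0 < A / t ^ k)]
    _ ≤ A / t ^ k * (v * (C * Real.exp (3 / 16 * v ^ 2))) * Real.exp (-v ^ 2 / 4) := by
        gcongr; exact h v
    _ = A / t ^ k * v * C * (Real.exp (3 / 16 * v ^ 2) * Real.exp (-v ^ 2 / 4)) := by ring
    _ = _ := by
        rw [hexp]
        simp only [levyPoly, Polynomial.eval_X, pow_zero]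
        ring

lemma image_const_div_Ioi {c : ℝ} (hc : 0 < c) :
    (fun v : ℝ => c / v) '' Set.Ioi 0 = Set.Ioi 0 := by
  ext u
  constructor
  · rintro ⟨s, hs, rfl⟩
    have : 0 < s := hs
    exact div_pos hc this
  · intro hu
    have : 0 < u := hu
    exact ⟨c / u, div_pos hc this, by field_simp⟩

lemma injOn_const_div_Ioi {c : ℝ} (hc : 0 < c) : Set.InjOn (fun v : ℝ => c / v) (Set.Ioi 0) := by
  intro a ha b hb h
  have ha : 0 < a := ha
  have hb : 0 < b := hb
  have h : c / a = c / b := h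
  field_simp at h
  exact h.symm

lemma hasDerivAt_const_div (c : ℝ) {s : ℝ} (hs : s ≠ 0) :
    HasDerivAt (fun v : ℝ => c / v) (-(c / s ^ 2)) s := by
  simp only [div_eq_mul_inv]
  exact ((hasDerivAt_inv hs).const_mul c).congr_deriv (by ring)

/-- The change of variables `u = t²/4s` in the subordination formula. -/
lemma integral_subordination (G : ℝ → ℝ) {t : ℝ} (ht : 0 < t) :
    1 / Real.sqrt Real.pi *
      ∫ u in Set.Ioi (0 : ℝ), Real.exp (-u) / Real.sqrt u * G (t ^ 2 / (4 * u))
    = ∫ s in Set.Ioi (0 : ℝ), levy 0 t s * G s := by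
  have hc : 0 < t ^ 2 / 4 := by positivity
  have h := integral_image_eq_integral_abs_deriv_smul (measurableSet_Ioi (a := (0 : ℝ)))
    (fun s hs => (hasDerivAt_const_div (t ^ 2 / 4) (ne_of_gt hs)).hasDerivWithinAt)
    (injOn_const_div_Ioi hc) (fun u => Real.exp (-u) / Real.sqrt u * G (t ^ 2 / (4 * u)))
  rw [image_const_div_Ioi hc] at h
  rw [h, ← integral_const_mul]
  refine setIntegral_congr_fun measurableSet_Ioi fun s hs => ?_
  have hs : 0 < s := hs
  simp only [smul_eq_mul]
  have e1 : t ^ 2 / (4 * (t ^ 2 / 4 / s)) = s := by field_simp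
  have e2 : Real.sqrt (t ^ 2 / 4 / s) = t / (2 * Real.sqrt s) := by
    rw [Real.sqrt_div (by positivity), Real.sqrt_div (by positivity), Real.sqrt_sq ht.le,
      show (4 : ℝ) = 2 ^ 2 by norm_num, Real.sqrt_sq (by norm_num)]
    field_simp
  have e3 : t ^ 2 / 4 / s = t ^ 2 / (4 * s) := by field_simp
  rw [e1, e2, e3, levy_zero_eq t s hs, abs_neg, abs_of_pos (by positivity)]
  have hss : Real.sqrt s * Real.sqrt s = s := Real.mul_self_sqrt hs.le
  have : Real.sqrt s ≠ 0 := by positivity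
  field_simp
  rw [pow_two (Real.sqrt s), hss]
  ring

lemma integral_levy {t : ℝ} (ht : 0 < t) : ∫ s in Set.Ioi (0 : ℝ), levy 0 t s = 1 := by
  have h := integral_subordination (fun _ => 1) ht
  simp only [mul_one] at h
  rw [← h, div_mul_eq_mul_div, one_mul, div_eq_one_iff_eq (by positivity), ← Real.Gamma_one_half_eq,
    Real.Gamma_eq_integral (by norm_num)]
  refine setIntegral_congr_fun measurableSet_Ioi fun s hs => ?_
  have hs : 0 < s := hs
  rw [div_eq_mul_inv, Real.sqrt_eq_rpow, ← Real.rpow_neg hs.le]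
  norm_num

lemma integrable_levy {t : ℝ} (ht : 0 < t) :
    Integrable (fun s => levy 0 t s) (volume.restrict (Set.Ioi (0 : ℝ))) :=
  .of_integral_ne_zero (by rw [integral_levy ht]; exact one_ne_zero)

lemma lintegral_levy {t : ℝ} (ht : 0 < t) :
    ∫⁻ s in Set.Ioi (0 : ℝ), ENNReal.ofReal (levy 0 t s) = 1 := by
  rw [← ofReal_integral_eq_lintegral_ofReal (integrable_levy ht), integral_levy ht,
    ENNReal.ofReal_one]
  filter_upwards [ae_restrict_mem measurableSet_Ioi] with s hs
  exact (levy_zero_pos ht hs).le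

/-- Differentiation under the integral sign for integrals of stable densities. No domination
hypothesis is needed: on `(t/2, 3t/2)` every derivative is dominated by a multiple of the density
at time `t/4`. -/
lemma hasDerivAt_integral_levy {Ω : Type*} [MeasurableSpace Ω] {ν : Measure Ω} {σ g : Ω → ℝ}
    (hσm : Measurable σ) (hσ : ∀ᵐ ω ∂ν, 0 < σ ω) (hg : AEStronglyMeasurable g ν)
    (hint : ∀ t, 0 < t → Integrable (fun ω => levy 0 t (σ ω) * g ω) ν) (k : ℕ) {t : ℝ}
    (ht : 0 < t) :
    Integrable (fun ω => levy k t (σ ω) * g ω) ν ∧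
      HasDerivAt (fun t => ∫ ω, levy k t (σ ω) * g ω ∂ν)
        (∫ ω, levy (k + 1) t (σ ω) * g ω ∂ν) t := by
  have hm : ∀ k t, AEStronglyMeasurable (fun ω => levy k t (σ ω) * g ω) ν := fun k t =>
    (measurable_levy k measurable_const hσm).aestronglyMeasurable.mul hg
  have hI : ∀ k t, 0 < t → Integrable (fun ω => levy k t (σ ω) * g ω) ν := by
    intro k t ht
    obtain ⟨C, hC, h⟩ := exists_abs_levy_le k
    refine ((hint (t / 2) (by positivity)).const_mul (C / t ^ k)).mono (hm k t) ?_
    filter_upwards [hσ] with ω hω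
    have := levy_zero_pos (half_pos ht) hω
    rw [Real.norm_eq_abs, Real.norm_eq_abs, abs_mul, abs_mul, abs_mul,
      abs_of_pos (show 0 < C / t ^ k by positivity), abs_of_pos this, ← mul_assoc]
    gcongr
    exact h t _ ht hω
  refine ⟨hI k t ht, ?_⟩
  obtain ⟨C, hC, h⟩ := exists_abs_levy_le (k + 1)
  refine (hasDerivAt_integral_of_dominated_loc_of_deriv_le (s := Set.Ioo (t / 2) (3 * t / 2))
    (F' := fun t ω => levy (k + 1) t (σ ω) * g ω)
    (bound := fun ω => C / (t / 2) ^ (k + 1) * (3 * |levy 0 (t / 4) (σ ω) * g ω|))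
    (Ioo_mem_nhds (by linarith) (by linarith)) (Filter.Eventually.of_forall fun t => hm k t)
    (hI k t ht) (hm _ t) ?_ ?_ ?_).2
  · filter_upwards [hσ] with ω hω x hx
    obtain ⟨hx1, hx2⟩ := hx
    have hx0 : 0 < x := by linarith
    have h4 := levy_zero_pos (show 0 < t / 4 by positivity) hω
    have h3 : levy 0 (x / 2) (σ ω) ≤ 3 * levy 0 (t / 4) (σ ω) := by
      rw [levy_zero_eq _ _ hω, levy_zero_eq _ _ hω]
      have : Real.exp (-((x / 2) ^ 2 / (4 * σ ω))) ≤ Real.exp (-((t / 4) ^ 2 / (4 * σ ω))) := by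
        have : (t / 4) ^ 2 ≤ (x / 2) ^ 2 := pow_le_pow_left₀ (by positivity) (by linarith) 2
        gcongr
      rw [← mul_assoc, ← mul_div_assoc]
      gcongr
      linarith
    rw [Real.norm_eq_abs, abs_mul, abs_mul, abs_of_pos h4, ← mul_assoc, ← mul_assoc]
    gcongr
    calc |levy (k + 1) x (σ ω)| ≤ C / x ^ (k + 1) * levy 0 (x / 2) (σ ω) := h _ _ hx0 hω
      _ ≤ C / (t / 2) ^ (k + 1) * (3 * levy 0 (t / 4) (σ ω)) := by
          have := levy_zero_pos (half_pos hx0) hω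
          gcongr
      _ = _ := by ring
  · exact ((hint (t / 4) (by positivity)).abs.const_mul 3).const_mul _
  · filter_upwards with ω x hx
    exact (hasDerivAt_levy k x _).mul_const _

lemma iteratedDeriv_integral_levy {Ω : Type*} [MeasurableSpace Ω] {ν : Measure Ω} {σ g : Ω → ℝ}
    (hσm : Measurable σ) (hσ : ∀ᵐ ω ∂ν, 0 < σ ω) (hg : AEStronglyMeasurable g ν)
    (hint : ∀ t, 0 < t → Integrable (fun ω => levy 0 t (σ ω) * g ω) ν) (k : ℕ) {t : ℝ}
    (ht : 0 < t) :
    iteratedDeriv k (fun t => ∫ ω, levy 0 t (σ ω) * g ω ∂ν) t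
      = ∫ ω, levy k t (σ ω) * g ω ∂ν := by
  induction k generalizing t with
  | zero => simp
  | succ k ih =>
    rw [iteratedDeriv_succ]
    have h := (hasDerivAt_integral_levy hσm hσ hg hint k ht).2
    refine HasDerivAt.deriv (h.congr_of_eventuallyEq ?_)
    filter_upwards [Ioi_mem_nhds ht] with s hs
    exact ih hs

/-! ### The convolution identity for stable densities -/

/-- The map `v ↦ a v - b / v` is a bijection from `(0, ∞)` onto the line. -/
lemma image_glasser {a b : ℝ} (ha : 0 < a) (hb : 0 < b) :
    (fun v : ℝ => a * v - b / v) '' Set.Ioi 0 = Set.univ := by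
  refine Set.eq_univ_of_forall fun y => ?_
  set D := Real.sqrt (y ^ 2 + 4 * a * b) with hD
  have hD2 : D ^ 2 = y ^ 2 + 4 * a * b := Real.sq_sqrt (by positivity)
  have hyD : |y| < D := by
    apply Real.lt_sqrt_of_sq_lt
    rw [sq_abs]
    have : 0 < 4 * a * b := by positivity
    linarith
  have hpos : 0 < y + D := by linarith [neg_abs_le y]
  refine ⟨(y + D) / (2 * a), div_pos hpos (by positivity), ?_⟩
  have := hpos.ne'
  simp only
  field_simp
  linear_combination hD2

lemma injOn_glasser {a b : ℝ} (ha : 0 < a) (hb : 0 < b) :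
    Set.InjOn (fun v : ℝ => a * v - b / v) (Set.Ioi 0) := by
  apply StrictMonoOn.injOn
  intro u hu v hv huv
  have hu : 0 < u := hu
  have h1 : a * u < a * v := by gcongr
  have h2 : b / v < b / u := by gcongr
  simp only
  linarith

lemma lintegral_exp_neg_mul_sq {c : ℝ} (hc : 0 < c) :
    ∫⁻ y : ℝ, ENNReal.ofReal (Real.exp (-c * y ^ 2))
      = ENNReal.ofReal (Real.sqrt (Real.pi / c)) := by
  rw [← ofReal_integral_eq_lintegral_ofReal (integrable_exp_neg_mul_sq hc)
    (Filter.Eventually.of_forall fun y => (Real.exp_pos _).le), integral_gaussian]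

/-- The Cauchy-Schlömilch transformation of the Gaussian integral, in the symmetrized form needed
for the convolution of stable densities. -/
lemma lintegral_glasser {a b c : ℝ} (ha : 0 < a) (hb : 0 < b) (hc : 0 < c) :
    ∫⁻ v in Set.Ioi (0 : ℝ), ENNReal.ofReal ((1 + 1 / v ^ 2) *
      Real.exp (-c * (a * v - b / v) ^ 2))
    = ENNReal.ofReal (Real.sqrt (Real.pi / c) * ((a + b) / (2 * a * b))) := by
  set E : ℝ → ℝ := fun v => Real.exp (-c * (a * v - b / v) ^ 2) with hE
  have hEm : Measurable E := by fun_prop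
  set I := ∫⁻ v in Set.Ioi (0 : ℝ), ENNReal.ofReal (E v) with hI
  set J := ∫⁻ v in Set.Ioi (0 : ℝ), ENNReal.ofReal (1 / v ^ 2 * E v) with hJ
  -- The substitution `y = a v - b / v` maps `(0, ∞)` onto the line.
  have h1 : ENNReal.ofReal a * I + ENNReal.ofReal b * J
      = ENNReal.ofReal (Real.sqrt (Real.pi / c)) := by
    have h := lintegral_image_eq_lintegral_abs_deriv_mul (measurableSet_Ioi (a := (0 : ℝ)))
      (f := fun v : ℝ => a * v - b / v) (f' := fun v => a + b / v ^ 2)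
      (fun s hs => ((((hasDerivAt_id s).const_mul a).sub
        (hasDerivAt_const_div b (ne_of_gt hs))).congr_deriv (by ring)).hasDerivWithinAt)
      (injOn_glasser ha hb) (fun y => ENNReal.ofReal (Real.exp (-c * y ^ 2)))
    rw [image_glasser ha hb, setLIntegral_univ, lintegral_exp_neg_mul_sq hc] at h
    rw [h, hI, hJ, ← lintegral_const_mul _ (by fun_prop), ← lintegral_const_mul _ (by fun_prop),
      ← lintegral_add_left (by fun_prop)]
    refine setLIntegral_congr_fun measurableSet_Ioi fun v hv => ?_
    have hv : 0 < v := hv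
    have hEv : 0 < E v := Real.exp_pos _
    rw [abs_of_pos (by positivity), ← ENNReal.ofReal_mul ha.le, ← ENNReal.ofReal_mul hb.le,
      ← ENNReal.ofReal_mul (by positivity), ← ENNReal.ofReal_add (by positivity) (by positivity)]
    congr 1
    simp only [hE]
    ring
  -- The substitution `v ↦ b / (a v)` leaves the exponent unchanged.
  have h2 : ENNReal.ofReal a * I = ENNReal.ofReal b * J := by
    have hba : 0 < b / a := by positivity
    have h := lintegral_image_eq_lintegral_abs_deriv_mul (measurableSet_Ioi (a := (0 : ℝ)))
      (fun s hs => (hasDerivAt_const_div (b / a) (ne_of_gt hs)).hasDerivWithinAt)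
      (injOn_const_div_Ioi hba) (fun y => ENNReal.ofReal (E y))
    rw [image_const_div_Ioi hba, ← hI] at h
    rw [h, hJ, ← lintegral_const_mul _ (by fun_prop), ← lintegral_const_mul _ (by fun_prop)]
    refine setLIntegral_congr_fun measurableSet_Ioi fun v hv => ?_
    have hv : 0 < v := hv
    have hEv : 0 < E v := Real.exp_pos _
    have hEE : E (b / a / v) = E v := by
      simp only [hE]
      congr 1
      field_simp
      ring
    rw [hEE, abs_neg, abs_of_pos (by positivity), ← ENNReal.ofReal_mul (by positivity),
      ← ENNReal.ofReal_mul ha.le, ← ENNReal.ofReal_mul hb.le]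
    congr 1
    field_simp
  have h3 : ∀ {e : ℝ} {K : ℝ≥0∞}, 0 < e →
      ENNReal.ofReal e * K + ENNReal.ofReal e * K = ENNReal.ofReal (Real.sqrt (Real.pi / c)) →
      K = ENNReal.ofReal (Real.sqrt (Real.pi / c) / (2 * e)) := by
    intro e K he h
    rw [← two_mul, ← mul_assoc] at h
    have e2 : (2 : ℝ≥0∞) * ENNReal.ofReal e = ENNReal.ofReal (2 * e) := by
      rw [ENNReal.ofReal_mul (by norm_num)]; simp
    rw [e2] at h
    rw [ENNReal.ofReal_div_of_pos (by positivity)]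
    rw [ENNReal.eq_div_iff (by simpa using he) ENNReal.ofReal_ne_top]
    exact h
  have hIv := h3 ha (by rw [← h1, ← h2])
  have hJv := h3 hb (by rw [← h1, h2])
  have : ∫⁻ v in Set.Ioi (0 : ℝ), ENNReal.ofReal ((1 + 1 / v ^ 2) * E v) = I + J := by
    rw [hI, hJ, ← lintegral_add_left (by fun_prop)]
    refine lintegral_congr fun v => ?_
    have hEv : 0 < E v := Real.exp_pos _
    rw [← ENNReal.ofReal_add hEv.le (by positivity)]
    congr 1
    ring
  rw [this, hIv, hJv, ← ENNReal.ofReal_add (by positivity) (by positivity)]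
  congr 1
  field_simp
  ring

/-- The convolution integral of two stable densities. The substitution `s = S / (1 + v²)` turns it
into an integral of Cauchy-Schlömilch type. -/
lemma lintegral_levy_mul_levy {a b S : ℝ} (ha : 0 < a) (hb : 0 < b) (hS : 0 < S) :
    ∫⁻ s in Set.Ioo 0 S, ENNReal.ofReal (levy 0 a s) * ENNReal.ofReal (levy 0 b (S - s))
      = ENNReal.ofReal (levy 0 (a + b) S) := by
  have himg : (fun v : ℝ => S / (1 + v ^ 2)) '' Set.Ioi 0 = Set.Ioo 0 S := by
    ext s
    constructor
    · rintro ⟨v, hv, rfl⟩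
      have hv : 0 < v := hv
      refine ⟨by positivity, ?_⟩
      simp only
      rw [div_lt_iff₀ (by positivity)]
      nlinarith [mul_pos hS (pow_pos hv 2)]
    · rintro ⟨h1, h2⟩
      have h3 : 0 < (S - s) / s := div_pos (by linarith) h1
      refine ⟨Real.sqrt ((S - s) / s), Real.sqrt_pos.mpr h3, ?_⟩
      simp only
      rw [Real.sq_sqrt h3.le]
      field_simp
      ring
  have hinj : Set.InjOn (fun v : ℝ => S / (1 + v ^ 2)) (Set.Ioi 0) := by
    apply StrictAntiOn.injOn
    intro u hu v hv huv
    have hu : 0 < u := hu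
    simp only
    gcongr
  have hder : ∀ v ∈ Set.Ioi (0 : ℝ), HasDerivWithinAt (fun v : ℝ => S / (1 + v ^ 2))
      (-(S / (1 + v ^ 2) ^ 2 * (2 * v))) (Set.Ioi 0) v := by
    intro v hv
    have h1 : HasDerivAt (fun v : ℝ => 1 + v ^ 2) (2 * v) v := by
      simpa using (hasDerivAt_pow 2 v).const_add 1
    have := (hasDerivAt_const_div S (by positivity : 1 + v ^ 2 ≠ 0)).comp v h1
    exact (this.congr_deriv (by ring)).hasDerivWithinAt
  have h := lintegral_image_eq_lintegral_abs_deriv_mul measurableSet_Ioi hder hinj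
    (fun s => ENNReal.ofReal (levy 0 a s) * ENNReal.ofReal (levy 0 b (S - s)))
  rw [himg] at h
  rw [h]
  have key : ∀ v ∈ Set.Ioi (0 : ℝ), ENNReal.ofReal |-(S / (1 + v ^ 2) ^ 2 * (2 * v))| *
      (ENNReal.ofReal (levy 0 a (S / (1 + v ^ 2))) *
        ENNReal.ofReal (levy 0 b (S - S / (1 + v ^ 2))))
      = ENNReal.ofReal (a * b / (2 * Real.pi * S ^ 2) * Real.exp (-((a + b) ^ 2 / (4 * S)))) *
        ENNReal.ofReal ((1 + 1 / v ^ 2) * Real.exp (-(1 / (4 * S)) * (a * v - b / v) ^ 2)) := by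
    intro v hv
    have hv : 0 < v := hv
    have e1 : S - S / (1 + v ^ 2) = S * v ^ 2 / (1 + v ^ 2) := by field_simp; ring
    have hs1 : 0 < S / (1 + v ^ 2) := by positivity
    have hs2 : 0 < S * v ^ 2 / (1 + v ^ 2) := by positivity
    rw [e1, abs_neg, abs_of_pos (by positivity),
      ← ENNReal.ofReal_mul (levy_zero_pos ha hs1).le, ← ENNReal.ofReal_mul (by positivity),
      ← ENNReal.ofReal_mul (by positivity), levy_zero_eq _ _ hs1, levy_zero_eq _ _ hs2]
    congr 1
    have e2 : Real.sqrt (S / (1 + v ^ 2)) * Real.sqrt (S * v ^ 2 / (1 + v ^ 2))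
        = S * v / (1 + v ^ 2) := by
      rw [← Real.sqrt_mul hs1.le, Real.sqrt_eq_iff_mul_self_eq (by positivity) (by positivity)]
      field_simp
    have e3 : Real.sqrt Real.pi * Real.sqrt Real.pi = Real.pi :=
      Real.mul_self_sqrt Real.pi_pos.le
    have e4 : Real.exp (-(a ^ 2 / (4 * (S / (1 + v ^ 2))))) *
        Real.exp (-(b ^ 2 / (4 * (S * v ^ 2 / (1 + v ^ 2)))))
        = Real.exp (-((a + b) ^ 2 / (4 * S))) *
          Real.exp (-(1 / (4 * S)) * (a * v - b / v) ^ 2) := by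
      rw [← Real.exp_add, ← Real.exp_add]
      congr 1
      field_simp
      ring
    set A := Real.sqrt (S / (1 + v ^ 2))
    set B := Real.sqrt (S * v ^ 2 / (1 + v ^ 2))
    set P := Real.sqrt Real.pi
    have hA : 0 < A := Real.sqrt_pos.mpr hs1
    have hB : 0 < B := Real.sqrt_pos.mpr hs2
    calc _ = S / (1 + v ^ 2) ^ 2 * (2 * v) * (a * b / (4 * (P * P) * (S / (1 + v ^ 2)) *
          (S * v ^ 2 / (1 + v ^ 2)) * (A * B))) *
          (Real.exp (-(a ^ 2 / (4 * (S / (1 + v ^ 2))))) *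
            Real.exp (-(b ^ 2 / (4 * (S * v ^ 2 / (1 + v ^ 2)))))) := by
          field_simp; ring
      _ = _ := by
          rw [e4, e2, e3]
          field_simp
          ring
  rw [setLIntegral_congr_fun measurableSet_Ioi key, lintegral_const_mul _ (by fun_prop),
    lintegral_glasser ha hb (by positivity), ← ENNReal.ofReal_mul (by positivity),
    levy_zero_eq _ _ hS]
  congr 1
  have e5 : Real.sqrt (Real.pi / (1 / (4 * S))) = 2 * Real.sqrt Real.pi * Real.sqrt S := by
    rw [show Real.pi / (1 / (4 * S)) = (2 * Real.sqrt Real.pi * Real.sqrt S) ^ 2 by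
      rw [mul_pow, mul_pow, Real.sq_sqrt Real.pi_pos.le, Real.sq_sqrt hS.le]; field_simp; ring]
    exact Real.sqrt_sq (by positivity)
  rw [e5]
  have e3 : Real.sqrt Real.pi ^ 2 = Real.pi := Real.sq_sqrt Real.pi_pos.le
  have e6 : Real.sqrt S ^ 2 = S := Real.sq_sqrt hS.le
  have hA : 0 < Real.sqrt S := Real.sqrt_pos.mpr hS
  have hP : 0 < Real.sqrt Real.pi := Real.sqrt_pos.mpr Real.pi_pos
  field_simp
  rw [e6, e3]

/-- The stable densities form a convolution semigroup. -/
lemma lintegral_levy_comp {a b : ℝ} (ha : 0 < a) (hb : 0 < b) {G : ℝ → ℝ≥0∞}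
    (hG : Measurable G) :
    ∫⁻ s in Set.Ioi (0 : ℝ), ∫⁻ u in Set.Ioi (0 : ℝ),
      ENNReal.ofReal (levy 0 a s) * ENNReal.ofReal (levy 0 b u) * G (s + u)
    = ∫⁻ S in Set.Ioi (0 : ℝ), ENNReal.ofReal (levy 0 (a + b) S) * G S := by
  set A : ℝ → ℝ≥0∞ := (Set.Ioi 0).indicator fun s => ENNReal.ofReal (levy 0 a s) with hA
  set B : ℝ → ℝ≥0∞ := (Set.Ioi 0).indicator fun s => ENNReal.ofReal (levy 0 b s) with hB
  have hAm : Measurable A := Measurable.indicator (by fun_prop) measurableSet_Ioi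
  have hBm : Measurable B := Measurable.indicator (by fun_prop) measurableSet_Ioi
  have h1 : ∫⁻ s in Set.Ioi (0 : ℝ), ∫⁻ u in Set.Ioi (0 : ℝ),
      ENNReal.ofReal (levy 0 a s) * ENNReal.ofReal (levy 0 b u) * G (s + u)
      = ∫⁻ s, ∫⁻ u, A s * B u * G (s + u) := by
    rw [← lintegral_indicator measurableSet_Ioi]
    refine lintegral_congr fun s => ?_
    by_cases hs : s ∈ Set.Ioi (0 : ℝ)
    · rw [Set.indicator_of_mem hs, ← lintegral_indicator measurableSet_Ioi]
      refine lintegral_congr fun u => ?_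
      by_cases hu : u ∈ Set.Ioi (0 : ℝ)
      · simp only [hA, hB, Set.indicator_of_mem hs, Set.indicator_of_mem hu]
      · simp only [hB, Set.indicator_of_notMem hu, mul_zero, zero_mul]
    · simp [hA, Set.indicator_of_notMem hs]
  have h2 : ∀ s, ∫⁻ u, A s * B u * G (s + u) = ∫⁻ S, A s * B (S - s) * G S := by
    intro s
    rw [← lintegral_sub_right_eq_self (fun u => A s * B u * G (s + u)) s]
    refine lintegral_congr fun u => ?_
    rw [add_sub_cancel]
  rw [h1]
  simp_rw [h2]
  rw [lintegral_lintegral_swap (by fun_prop), ← lintegral_indicator measurableSet_Ioi]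
  refine lintegral_congr fun S => ?_
  rw [lintegral_mul_const _ (by fun_prop)]
  have h3 : ∀ s, A s * B (S - s) = (Set.Ioo 0 S).indicator
      (fun s => ENNReal.ofReal (levy 0 a s) * ENNReal.ofReal (levy 0 b (S - s))) s := by
    intro s
    by_cases h1 : 0 < s
    · by_cases h2 : s < S
      · simp [hA, hB, h1, h2]
      · simp [hB, h2]
    · simp [hA, h1]
  simp_rw [h3]
  rw [lintegral_indicator measurableSet_Ioo]
  by_cases hS : 0 < S
  · rw [Set.indicator_of_mem (by exact hS), lintegral_levy_mul_levy ha hb hS]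
  · rw [Set.indicator_of_notMem (by exact hS), Set.Ioo_eq_empty hS]
    simp

/-! ### Kernel representations of the two semigroups -/

/-- The factor `(1 - e^{-2s})^{-d/2}` of the Mehler kernel. -/
def mehlerConst (d : ℕ) (s : ℝ) : ℝ := 1 / ouVar s ^ ((d : ℝ) / 2)

lemma mehlerConst_pos (d : ℕ) {s : ℝ} (hs : 0 < s) : 0 < mehlerConst d s := by
  have := ouVar_pos hs
  unfold mehlerConst; positivity

lemma ornsteinUhlenbeck_eq {d : ℕ} (t : ℝ) (f : Space d → ℝ) (x : Space d) :
    ornsteinUhlenbeck t f x = ∫ y, mehler t x y * f y ∂(gaussian d) := by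
  rw [ornsteinUhlenbeck, ← integral_const_mul]
  simp only [mehler, mul_assoc]

lemma integrable_mehler_mul {d : ℕ} {t : ℝ} (ht : 0 < t) {f : Space d → ℝ}
    (hf : Integrable f (gaussian d)) (x : Space d) :
    Integrable (fun y => mehler t x y * f y) (gaussian d) := by
  refine hf.bdd_mul (c := mehlerConst d t * Real.exp (‖x‖ ^ 2))
    (measurable_mehler measurable_const measurable_const measurable_id).aestronglyMeasurable
    (Filter.Eventually.of_forall fun y => ?_)
  rw [Real.norm_eq_abs, abs_of_pos (mehler_pos ht x y)]
  exact mehler_le ht x y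

lemma abs_ornsteinUhlenbeck_le {d : ℕ} {t : ℝ} (ht : 0 < t) {f : Space d → ℝ}
    (hf : Integrable f (gaussian d)) (x : Space d) :
    |ornsteinUhlenbeck t f x|
      ≤ mehlerConst d t * (Real.exp (‖x‖ ^ 2) * ∫ y, |f y| ∂(gaussian d)) := by
  rw [ornsteinUhlenbeck_eq, ← mul_assoc, ← integral_const_mul]
  refine abs_integral_le_integral_abs.trans (integral_mono (integrable_mehler_mul ht hf x).abs
    (hf.abs.const_mul _) fun y => ?_)
  simp only [abs_mul, abs_of_pos (mehler_pos ht x y)]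
  gcongr
  exact mehler_le ht x y

lemma measurable_ornsteinUhlenbeck {d : ℕ} {f : Space d → ℝ}
    (hf : AEStronglyMeasurable f (gaussian d)) {Ω : Type*} [MeasurableSpace Ω] {t : Ω → ℝ}
    {x : Ω → Space d} (ht : Measurable t) (hx : Measurable x) :
    Measurable fun ω => ornsteinUhlenbeck (t ω) f (x ω) := by
  have h : ∀ ω, ornsteinUhlenbeck (t ω) f (x ω)
      = ∫ y, mehler (t ω) (x ω) y * hf.mk f y ∂(gaussian d) := by
    intro ω
    rw [ornsteinUhlenbeck_eq]
    refine integral_congr_ae ?_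
    filter_upwards [hf.ae_eq_mk] with y hy
    rw [hy]
  simp_rw [h]
  have hmk := hf.stronglyMeasurable_mk.measurable
  have hm1 : Measurable fun z : Ω × Space d => mehler (t z.1) (x z.1) z.2 :=
    measurable_mehler (by fun_prop) (by fun_prop) (by fun_prop)
  have hm : StronglyMeasurable fun z : Ω × Space d =>
      mehler (t z.1) (x z.1) z.2 * hf.mk f z.2 :=
    (hm1.mul (hmk.comp measurable_snd)).stronglyMeasurable
  exact hm.integral_prod_right'.measurable

/-- The stable density vanishes at `s = 0` fast enough to absorb the singularity of the Mehler
kernel. The constant is uniform for `t` bounded away from `0`, which gives the decay in time of the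
derivatives. -/
lemma exists_levy_mul_mehlerConst_le (d : ℕ) {t₀ : ℝ} (ht₀ : 0 < t₀) :
    ∃ C, 0 < C ∧ ∀ t s : ℝ, t₀ ≤ t → 0 < s →
      levy 0 t s * mehlerConst d s ≤ C * levy 0 (t / 2) s := by
  obtain ⟨C, hC, h⟩ := exists_abs_eval_le_exp ((1 + Polynomial.C (1 / 2) * Polynomial.X ^ 2) ^ d)
    (c := 3 * t₀ ^ 2 / 16) (by positivity)
  refine ⟨2 * C, by positivity, fun t s ht hs => ?_⟩
  have ht0 : 0 < t := ht₀.trans_le ht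
  have hr := ouVar_pos hs
  have h1 : 1 / ouVar s ≤ 1 + 1 / (2 * s) := by
    have e : Real.exp (-2 * s) ≤ 1 / (1 + 2 * s) := by
      rw [show -2 * s = -(2 * s) by ring, Real.exp_neg, ← one_div]
      exact one_div_le_one_div_of_le (by positivity) (by linarith [Real.add_one_le_exp (2 * s)])
    have : 2 * s / (1 + 2 * s) ≤ ouVar s := by
      have : 2 * s / (1 + 2 * s) = 1 - 1 / (1 + 2 * s) := by field_simp; ring
      rw [ouVar]; linarith
    calc 1 / ouVar s ≤ 1 / (2 * s / (1 + 2 * s)) :=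
          one_div_le_one_div_of_le (by positivity) this
      _ = _ := by field_simp; ring
  have h2 : mehlerConst d s ≤ (1 + 1 / (2 * s)) ^ d := by
    have e : mehlerConst d s = (1 / ouVar s) ^ ((d : ℝ) / 2) := by
      rw [mehlerConst, Real.div_rpow zero_le_one hr.le, Real.one_rpow]
    rw [e, ← Real.rpow_natCast]
    have h3 : (1 : ℝ) ≤ 1 + 1 / (2 * s) := by
      have : 0 < 1 / (2 * s) := by positivity
      linarith
    have hd : (0 : ℝ) ≤ d := Nat.cast_nonneg d
    calc _ ≤ (1 + 1 / (2 * s)) ^ ((d : ℝ) / 2) :=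
          Real.rpow_le_rpow (by positivity) h1 (by positivity)
      _ ≤ _ := Real.rpow_le_rpow_of_exponent_le h3 (by linarith)
  -- The exponent `3 t² / 16 s` is the gap between `t² / 4 s` and `(t / 2)² / 4 s`.
  have h3 : (1 + 1 / (2 * s)) ^ d ≤ C * Real.exp (3 * t ^ 2 / (16 * s)) := by
    have := h (1 / Real.sqrt s)
    simp only [Polynomial.eval_pow, Polynomial.eval_add, Polynomial.eval_one, Polynomial.eval_mul,
      Polynomial.eval_C, Polynomial.eval_X, div_pow, Real.sq_sqrt hs.le, one_pow] at this
    rw [abs_of_nonneg (by positivity)] at this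
    calc _ = (1 + 1 / 2 * (1 / s)) ^ d := by congr 2; field_simp
      _ ≤ _ := this
      _ = C * Real.exp (3 * t₀ ^ 2 / (16 * s)) := by congr 2; field_simp
      _ ≤ _ := by gcongr
  have h4 : Real.exp (-(t ^ 2 / (4 * s))) * Real.exp (3 * t ^ 2 / (16 * s))
      = Real.exp (-((t / 2) ^ 2 / (4 * s))) := by
    rw [← Real.exp_add]; congr 1; field_simp; ring
  calc levy 0 t s * mehlerConst d s
      ≤ levy 0 t s * (C * Real.exp (3 * t ^ 2 / (16 * s))) := by
        have := levy_zero_pos ht0 hs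
        gcongr
        exact h2.trans h3
    _ = C * (t / (2 * Real.sqrt Real.pi * s * Real.sqrt s)) *
          (Real.exp (-(t ^ 2 / (4 * s))) * Real.exp (3 * t ^ 2 / (16 * s))) := by
        rw [levy_zero_eq _ _ hs]; ring
    _ = _ := by
        rw [h4, levy_zero_eq _ _ hs]; ring

lemma ae_pos_Ioi : ∀ᵐ s ∂(volume.restrict (Set.Ioi (0 : ℝ))), 0 < s :=
  ae_restrict_mem measurableSet_Ioi

lemma measurable_ou_left {d : ℕ} {f : Space d → ℝ} (hf : Integrable f (gaussian d))
    (x : Space d) : Measurable fun s => ornsteinUhlenbeck s f x :=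
  measurable_ornsteinUhlenbeck hf.aestronglyMeasurable measurable_id measurable_const

lemma integrable_levy_mul_ou {d : ℕ} {f : Space d → ℝ} (hf : Integrable f (gaussian d))
    (x : Space d) {t : ℝ} (ht : 0 < t) :
    Integrable (fun s => levy 0 t s * ornsteinUhlenbeck s f x)
      (volume.restrict (Set.Ioi (0 : ℝ))) := by
  obtain ⟨C, hC, h⟩ := exists_levy_mul_mehlerConst_le d ht
  refine ((integrable_levy (half_pos ht)).mul_const
    (C * (Real.exp (‖x‖ ^ 2) * ∫ y, |f y| ∂(gaussian d)))).mono'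
    ((measurable_levy 0 measurable_const measurable_id).mul
      (measurable_ou_left hf x)).aestronglyMeasurable ?_
  filter_upwards [ae_pos_Ioi] with s hs
  have h1 := levy_zero_pos ht hs
  have h2 : 0 ≤ ∫ y, |f y| ∂(gaussian d) := integral_nonneg fun y => abs_nonneg _
  rw [Real.norm_eq_abs, abs_mul, abs_of_pos h1]
  calc _ ≤ levy 0 t s * (mehlerConst d s * (Real.exp (‖x‖ ^ 2) * ∫ y, |f y| ∂(gaussian d))) := by
        gcongr; exact abs_ornsteinUhlenbeck_le hs hf x
    _ = levy 0 t s * mehlerConst d s * (Real.exp (‖x‖ ^ 2) * ∫ y, |f y| ∂(gaussian d)) := by ring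
    _ ≤ C * levy 0 (t / 2) s * (Real.exp (‖x‖ ^ 2) * ∫ y, |f y| ∂(gaussian d)) := by
        exact mul_le_mul_of_nonneg_right (h t s le_rfl hs) (by positivity)
    _ = _ := by ring

lemma poissonHermite_eq {d : ℕ} {t : ℝ} (ht : 0 < t) (f : Space d → ℝ) (x : Space d) :
    poissonHermite t f x
      = ∫ s in Set.Ioi (0 : ℝ), levy 0 t s * ornsteinUhlenbeck s f x :=
  integral_subordination (fun s => ornsteinUhlenbeck s f x) ht

lemma poissonDeriv_eq {d : ℕ} {f : Space d → ℝ} (hf : Integrable f (gaussian d)) (k : ℕ) {t : ℝ}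
    (ht : 0 < t) (x : Space d) :
    poissonDeriv k t f x
      = ∫ s in Set.Ioi (0 : ℝ), levy k t s * ornsteinUhlenbeck s f x := by
  have h := iteratedDeriv_integral_levy (σ := fun s => s) measurable_id ae_pos_Ioi
    (measurable_ou_left hf x).aestronglyMeasurable
    (fun t ht => integrable_levy_mul_ou hf x ht) k ht
  rw [poissonDeriv, ← h]
  refine Filter.EventuallyEq.iteratedDeriv_eq k ?_
  filter_upwards [Ioi_mem_nhds ht] with s hs
  exact poissonHermite_eq hs f x

lemma hasDerivAt_poissonDeriv {d : ℕ} {f : Space d → ℝ} (hf : Integrable f (gaussian d)) (k : ℕ)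
    {t : ℝ} (ht : 0 < t) (x : Space d) :
    HasDerivAt (fun t => poissonDeriv k t f x) (poissonDeriv (k + 1) t f x) t := by
  rw [poissonDeriv_eq hf _ ht]
  refine (hasDerivAt_integral_levy (σ := fun s => s) measurable_id ae_pos_Ioi
    (measurable_ou_left hf x).aestronglyMeasurable
    (fun t ht => integrable_levy_mul_ou hf x ht) k ht).2.congr_of_eventuallyEq ?_
  filter_upwards [Ioi_mem_nhds ht] with s hs
  exact poissonDeriv_eq hf k hs x

lemma measurable_integral_levy_mul_ou {d : ℕ} {f : Space d → ℝ}
    (hf : AEStronglyMeasurable f (gaussian d)) (k : ℕ) {Ω : Type*} [MeasurableSpace Ω] {t : Ω → ℝ}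
    {x : Ω → Space d} (ht : Measurable t) (hx : Measurable x) :
    Measurable fun ω => ∫ s in Set.Ioi (0 : ℝ), levy k (t ω) s * ornsteinUhlenbeck s f (x ω) := by
  have hm1 : Measurable fun z : Ω × ℝ => ornsteinUhlenbeck z.2 f (x z.1) :=
    measurable_ornsteinUhlenbeck hf (by fun_prop) (by fun_prop)
  have hm : StronglyMeasurable fun z : Ω × ℝ =>
      levy k (t z.1) z.2 * ornsteinUhlenbeck z.2 f (x z.1) :=
    ((measurable_levy k (by fun_prop) (by fun_prop)).mul hm1).stronglyMeasurable
  exact hm.integral_prod_right'.measurable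

/-- The kernel of the Poisson-Hermite semigroup with respect to `γ_d`. -/
def poissonKernel {d : ℕ} (t : ℝ) (x y : Space d) : ℝ :=
  ∫ s in Set.Ioi (0 : ℝ), levy 0 t s * mehler s x y

lemma integrable_levy_mul_mehler {d : ℕ} {t : ℝ} (ht : 0 < t) (x y : Space d) :
    Integrable (fun s => levy 0 t s * mehler s x y) (volume.restrict (Set.Ioi (0 : ℝ))) := by
  obtain ⟨C, hC, h⟩ := exists_levy_mul_mehlerConst_le d ht
  refine ((integrable_levy (half_pos ht)).mul_const (C * Real.exp (‖x‖ ^ 2))).mono'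
    ((measurable_levy 0 measurable_const measurable_id).mul
      (measurable_mehler measurable_id measurable_const measurable_const)).aestronglyMeasurable ?_
  filter_upwards [ae_pos_Ioi] with s hs
  have h1 := levy_zero_pos ht hs
  rw [Real.norm_eq_abs, abs_mul, abs_of_pos h1, abs_of_pos (mehler_pos hs x y)]
  calc _ ≤ levy 0 t s * (mehlerConst d s * Real.exp (‖x‖ ^ 2)) := by
        gcongr; exact mehler_le hs x y
    _ = levy 0 t s * mehlerConst d s * Real.exp (‖x‖ ^ 2) := by ring
    _ ≤ C * levy 0 (t / 2) s * Real.exp (‖x‖ ^ 2) :=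
        mul_le_mul_of_nonneg_right (h t s le_rfl hs) (by positivity)
    _ = _ := by ring

lemma poissonKernel_nonneg {d : ℕ} {t : ℝ} (ht : 0 < t) (x y : Space d) :
    0 ≤ poissonKernel t x y :=
  setIntegral_nonneg measurableSet_Ioi fun _ hs =>
    (mul_pos (levy_zero_pos ht hs) (mehler_pos hs x y)).le

lemma ofReal_poissonKernel {d : ℕ} {t : ℝ} (ht : 0 < t) (x y : Space d) :
    ENNReal.ofReal (poissonKernel t x y)
      = ∫⁻ s in Set.Ioi (0 : ℝ), ENNReal.ofReal (levy 0 t s) * ENNReal.ofReal (mehler s x y) := by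
  rw [poissonKernel, ofReal_integral_eq_lintegral_ofReal (integrable_levy_mul_mehler ht x y)]
  · refine setLIntegral_congr_fun measurableSet_Ioi fun s hs => ?_
    exact ENNReal.ofReal_mul (levy_zero_pos ht hs).le
  · filter_upwards [ae_pos_Ioi] with s hs
    exact (mul_pos (levy_zero_pos ht hs) (mehler_pos hs x y)).le

lemma exists_poissonKernel_le {d : ℕ} {t : ℝ} (ht : 0 < t) (x : Space d) :
    ∃ C, 0 < C ∧ ∀ y, poissonKernel t x y ≤ C := by
  obtain ⟨C, hC, h⟩ := exists_levy_mul_mehlerConst_le d ht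
  refine ⟨C * Real.exp (‖x‖ ^ 2), by positivity, fun y => ?_⟩
  have e : C * Real.exp (‖x‖ ^ 2)
      = ∫ s in Set.Ioi (0 : ℝ), levy 0 (t / 2) s * (C * Real.exp (‖x‖ ^ 2)) := by
    rw [integral_mul_const, integral_levy (half_pos ht), one_mul]
  rw [e]
  refine setIntegral_mono_on (integrable_levy_mul_mehler ht x y)
    ((integrable_levy (half_pos ht)).mul_const _) measurableSet_Ioi fun s hs => ?_
  have hs : 0 < s := hs
  have h1 := levy_zero_pos ht hs
  calc _ ≤ levy 0 t s * (mehlerConst d s * Real.exp (‖x‖ ^ 2)) := by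
        gcongr; exact mehler_le hs x y
    _ = levy 0 t s * mehlerConst d s * Real.exp (‖x‖ ^ 2) := by ring
    _ ≤ C * levy 0 (t / 2) s * Real.exp (‖x‖ ^ 2) :=
        mul_le_mul_of_nonneg_right (h t s le_rfl hs) (by positivity)
    _ = _ := by ring

lemma measurable_poissonKernel {d : ℕ} (t : ℝ) {Ω : Type*} [MeasurableSpace Ω]
    {x y : Ω → Space d} (hx : Measurable x) (hy : Measurable y) :
    Measurable fun ω => poissonKernel t (x ω) (y ω) := by
  have hm1 : Measurable fun z : Ω × ℝ => mehler z.2 (x z.1) (y z.1) :=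
    measurable_mehler (by fun_prop) (by fun_prop) (by fun_prop)
  have hm : StronglyMeasurable fun z : Ω × ℝ => levy 0 t z.2 * mehler z.2 (x z.1) (y z.1) :=
    ((measurable_levy 0 (by fun_prop) (by fun_prop)).mul hm1).stronglyMeasurable
  exact hm.integral_prod_right'.measurable

/-- The Chapman-Kolmogorov identity for the Poisson-Hermite kernel. -/
lemma lintegral_poissonKernel_mul {d : ℕ} {a b : ℝ} (ha : 0 < a) (hb : 0 < b) (x z : Space d) :
    ∫⁻ y, ENNReal.ofReal (poissonKernel a x y) * ENNReal.ofReal (poissonKernel b y z)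
      ∂(gaussian d) = ENNReal.ofReal (poissonKernel (a + b) x z) := by
  have hm1 : Measurable fun w : ℝ × Space d => mehler w.1 x w.2 :=
    measurable_mehler (by fun_prop) (by fun_prop) (by fun_prop)
  have hm2 : Measurable fun w : ℝ × Space d => mehler w.1 w.2 z :=
    measurable_mehler (by fun_prop) (by fun_prop) (by fun_prop)
  have hm3 : Measurable fun s : ℝ => mehler s x z :=
    measurable_mehler (by fun_prop) (by fun_prop) (by fun_prop)
  have e1 : ∀ y, ENNReal.ofReal (poissonKernel a x y) * ENNReal.ofReal (poissonKernel b y z)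
      = ∫⁻ s in Set.Ioi (0 : ℝ), ∫⁻ u in Set.Ioi (0 : ℝ),
        (ENNReal.ofReal (levy 0 a s) * ENNReal.ofReal (levy 0 b u)) *
          (ENNReal.ofReal (mehler s x y) * ENNReal.ofReal (mehler u y z)) := by
    intro y
    rw [ofReal_poissonKernel ha, ofReal_poissonKernel hb, ← lintegral_mul_const _ (by fun_prop)]
    refine lintegral_congr fun s => ?_
    rw [← lintegral_const_mul _ (by fun_prop)]
    refine lintegral_congr fun u => ?_
    ring
  have hm4 : Measurable fun w : (Space d × ℝ) × ℝ => mehler w.1.2 x w.1.1 :=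
    measurable_mehler (by fun_prop) (by fun_prop) (by fun_prop)
  have hm5 : Measurable fun w : (Space d × ℝ) × ℝ => mehler w.2 w.1.1 z :=
    measurable_mehler (by fun_prop) (by fun_prop) (by fun_prop)
  simp_rw [e1]
  rw [lintegral_lintegral_swap, ofReal_poissonKernel (add_pos ha hb),
    ← lintegral_levy_comp ha hb (G := fun s => ENNReal.ofReal (mehler s x z)) (by fun_prop)]
  · refine setLIntegral_congr_fun measurableSet_Ioi fun s hs => ?_
    have hm6 : Measurable fun w : Space d × ℝ => mehler s x w.1 :=
      measurable_mehler (by fun_prop) (by fun_prop) (by fun_prop)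
    have hm7 : Measurable fun w : Space d × ℝ => mehler w.2 w.1 z :=
      measurable_mehler (by fun_prop) (by fun_prop) (by fun_prop)
    rw [lintegral_lintegral_swap (by fun_prop)]
    refine setLIntegral_congr_fun measurableSet_Ioi fun u hu => ?_
    have hm8 : Measurable fun w : Space d => mehler s x w :=
      measurable_mehler (by fun_prop) (by fun_prop) (by fun_prop)
    have hm9 : Measurable fun w : Space d => mehler u w z :=
      measurable_mehler (by fun_prop) (by fun_prop) (by fun_prop)
    rw [lintegral_const_mul _ (by fun_prop), lintegral_mehler_mul_mehler hs hu]
  · refine (Measurable.lintegral_prod_right' (f := fun w : (Space d × ℝ) × ℝ =>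
      (ENNReal.ofReal (levy 0 a w.1.2) * ENNReal.ofReal (levy 0 b w.2)) *
          (ENNReal.ofReal (mehler w.1.2 x w.1.1) * ENNReal.ofReal (mehler w.2 w.1.1 z)))
      (by fun_prop)).aemeasurable

/-! ### The semigroup property and derivatives in time -/

lemma integrable_poissonKernel_mul {d : ℕ} {t : ℝ} (ht : 0 < t) {f : Space d → ℝ}
    (hf : Integrable f (gaussian d)) (x : Space d) :
    Integrable (fun y => poissonKernel t x y * f y) (gaussian d) := by
  obtain ⟨C, hC, h⟩ := exists_poissonKernel_le ht x
  refine hf.bdd_mul (c := C)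
    (measurable_poissonKernel t measurable_const measurable_id).aestronglyMeasurable
    (Filter.Eventually.of_forall fun y => ?_)
  rw [Real.norm_eq_abs, abs_of_nonneg (poissonKernel_nonneg ht x y)]
  exact h y

/-- The Mehler kernel is doubly stochastic, so `γ_d` is invariant. -/
lemma lintegral_lintegral_mehler {d : ℕ} {s : ℝ} (hs : 0 < s) {h : Space d → ℝ≥0∞}
    (hh : AEMeasurable h (gaussian d)) :
    ∫⁻ x, ∫⁻ y, ENNReal.ofReal (mehler s x y) * h y ∂(gaussian d) ∂(gaussian d)
      = ∫⁻ y, h y ∂(gaussian d) := by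
  have hm : Measurable fun w : Space d × Space d => mehler s w.1 w.2 :=
    measurable_mehler (by fun_prop) (by fun_prop) (by fun_prop)
  rw [lintegral_lintegral_swap (hm.ennreal_ofReal.aemeasurable.mul hh.comp_snd)]
  refine lintegral_congr fun z => ?_
  simp_rw [mehler_comm s _ z]
  have hm' : Measurable fun w : Space d => mehler s z w :=
    measurable_mehler (by fun_prop) (by fun_prop) (by fun_prop)
  rw [lintegral_mul_const _ (by fun_prop), lintegral_mehler hs, one_mul]

/-- The transition operators contract `L¹(γ_d)`. -/
lemma lintegral_enorm_ou_le {d : ℕ} {s : ℝ} (hs : 0 < s) {f : Space d → ℝ}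
    (hf : AEStronglyMeasurable f (gaussian d)) :
    ∫⁻ y, ‖ornsteinUhlenbeck s f y‖ₑ ∂(gaussian d) ≤ ∫⁻ y, ‖f y‖ₑ ∂(gaussian d) := by
  refine (lintegral_mono fun y => ?_).trans_eq (lintegral_lintegral_mehler hs hf.aemeasurable.enorm)
  rw [ornsteinUhlenbeck_eq]
  refine (enorm_integral_le_lintegral_enorm _).trans (lintegral_mono fun z => ?_)
  rw [enorm_mul, Real.enorm_of_nonneg (mehler_pos hs y z).le]

lemma integrable_levy_mul_ou_prod {d : ℕ} {f : Space d → ℝ} (hf : Integrable f (gaussian d))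
    {t : ℝ} (ht : 0 < t) :
    Integrable (fun w : Space d × ℝ => levy 0 t w.2 * ornsteinUhlenbeck w.2 f w.1)
      ((gaussian d).prod (volume.restrict (Set.Ioi (0 : ℝ)))) := by
  have hm2 : Measurable fun w : Space d × ℝ => ornsteinUhlenbeck w.2 f w.1 :=
    measurable_ornsteinUhlenbeck hf.aestronglyMeasurable (by fun_prop) (by fun_prop)
  have hm : Measurable fun w : Space d × ℝ => levy 0 t w.2 * ornsteinUhlenbeck w.2 f w.1 := by
    fun_prop
  refine ⟨hm.aestronglyMeasurable, ?_⟩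
  rw [hasFiniteIntegral_def, lintegral_prod_symm' _ hm.enorm]
  calc _ ≤ ∫⁻ s in Set.Ioi (0 : ℝ), ENNReal.ofReal (levy 0 t s) *
        ∫⁻ y, ‖f y‖ₑ ∂(gaussian d) := by
        refine setLIntegral_mono' measurableSet_Ioi fun s hs => ?_
        have hs : 0 < s := hs
        have hm3 : Measurable fun y : Space d => ornsteinUhlenbeck s f y :=
          measurable_ornsteinUhlenbeck hf.aestronglyMeasurable (by fun_prop) (by fun_prop)
        simp only [enorm_mul]
        rw [lintegral_const_mul _ (by fun_prop), Real.enorm_of_nonneg (levy_zero_pos ht hs).le]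
        exact mul_le_mul' le_rfl (lintegral_enorm_ou_le hs hf.aestronglyMeasurable)
    _ < ∞ := by
        rw [lintegral_mul_const _ (by fun_prop), lintegral_levy ht, one_mul]
        exact hf.2

lemma integrable_levy_mul_kernel_mul_ou {d : ℕ} {f : Space d → ℝ}
    (hf : Integrable f (gaussian d)) {a t : ℝ} (ha : 0 < a) (ht : 0 < t) (x : Space d) :
    Integrable (fun w : Space d × ℝ =>
        levy 0 t w.2 * (poissonKernel a x w.1 * ornsteinUhlenbeck w.2 f w.1))
      ((gaussian d).prod (volume.restrict (Set.Ioi (0 : ℝ)))) := by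
  obtain ⟨C, hC, h⟩ := exists_poissonKernel_le ha x
  have hm1 : Measurable fun w : Space d × ℝ => poissonKernel a x w.1 :=
    measurable_poissonKernel a (by fun_prop) (by fun_prop)
  refine ((integrable_levy_mul_ou_prod hf ht).bdd_mul (c := C) hm1.aestronglyMeasurable
    (Filter.Eventually.of_forall fun w => ?_)).congr (Filter.Eventually.of_forall fun w => ?_)
  · rw [Real.norm_eq_abs, abs_of_nonneg (poissonKernel_nonneg ha x w.1)]
    exact h w.1
  · simp only
    ring

lemma poissonHermite_eq_kernel {d : ℕ} {t : ℝ} (ht : 0 < t) {f : Space d → ℝ}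
    (hf : Integrable f (gaussian d)) (x : Space d) :
    poissonHermite t f x = ∫ y, poissonKernel t x y * f y ∂(gaussian d) := by
  rw [poissonHermite_eq ht]
  simp_rw [ornsteinUhlenbeck_eq, ← integral_const_mul]
  rw [integral_integral_swap]
  · refine integral_congr_ae (Filter.Eventually.of_forall fun y => ?_)
    simp only [poissonKernel]
    rw [← integral_mul_const]
    simp only [mul_assoc]
  · obtain ⟨C, hC, h⟩ := exists_levy_mul_mehlerConst_le d ht
    have hm1 : Measurable fun w : ℝ × Space d => mehler w.1 x w.2 :=
      measurable_mehler (by fun_prop) (by fun_prop) (by fun_prop)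
    have hm2 : Measurable fun w : ℝ × Space d => levy 0 t w.1 := by fun_prop
    refine (((integrable_levy (half_pos ht)).mul_prod hf.abs).const_mul
      (C * Real.exp (‖x‖ ^ 2))).mono'
      (hm2.aestronglyMeasurable.mul
        (hm1.aestronglyMeasurable.mul hf.aestronglyMeasurable.comp_snd)) ?_
    have : ∀ᵐ w ∂((volume.restrict (Set.Ioi (0 : ℝ))).prod (gaussian d)), 0 < w.1 :=
      Measure.quasiMeasurePreserving_fst.ae ae_pos_Ioi
    filter_upwards [this] with w hw
    have h1 := levy_zero_pos ht hw
    simp only [Function.uncurry]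
    rw [Real.norm_eq_abs, abs_mul, abs_mul, abs_of_pos h1, abs_of_pos (mehler_pos hw x w.2)]
    calc _ ≤ levy 0 t w.1 * (mehlerConst d w.1 * Real.exp (‖x‖ ^ 2) * |f w.2|) := by
          gcongr; exact mehler_le hw x w.2
      _ = levy 0 t w.1 * mehlerConst d w.1 * (Real.exp (‖x‖ ^ 2) * |f w.2|) := by ring
      _ ≤ C * levy 0 (t / 2) w.1 * (Real.exp (‖x‖ ^ 2) * |f w.2|) :=
          mul_le_mul_of_nonneg_right (h t w.1 le_rfl hw) (by positivity)
      _ = _ := by ring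

lemma integral_kernel_mul_kernel {d : ℕ} {a b : ℝ} (ha : 0 < a) (hb : 0 < b) {f : Space d → ℝ}
    (hf : Integrable f (gaussian d)) (x : Space d) :
    ∫ y, poissonKernel a x y * ∫ z, poissonKernel b y z * f z ∂(gaussian d) ∂(gaussian d)
      = ∫ z, poissonKernel (a + b) x z * f z ∂(gaussian d) := by
  have hm0 : Measurable fun y => poissonKernel a x y :=
    measurable_poissonKernel a (by fun_prop) (by fun_prop)
  have hm1 : Measurable fun w : Space d × Space d => poissonKernel a x w.1 :=
    measurable_poissonKernel a (by fun_prop) (by fun_prop)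
  have hm2 : Measurable fun w : Space d × Space d => poissonKernel b w.1 w.2 :=
    measurable_poissonKernel b (by fun_prop) (by fun_prop)
  have hm3 : ∀ z, Measurable fun y : Space d => poissonKernel b y z := fun z =>
    measurable_poissonKernel b (by fun_prop) (by fun_prop)
  have e : ∀ z, Integrable (fun y => poissonKernel a x y * poissonKernel b y z) (gaussian d) ∧
      ∫ y, poissonKernel a x y * poissonKernel b y z ∂(gaussian d)
        = poissonKernel (a + b) x z := by
    intro z
    have h1 : ∫⁻ y, ENNReal.ofReal (poissonKernel a x y * poissonKernel b y z) ∂(gaussian d)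
        = ENNReal.ofReal (poissonKernel (a + b) x z) := by
      simp_rw [ENNReal.ofReal_mul (poissonKernel_nonneg ha x _)]
      exact lintegral_poissonKernel_mul ha hb x z
    have hnn : ∀ y, 0 ≤ poissonKernel a x y * poissonKernel b y z := fun y =>
      mul_nonneg (poissonKernel_nonneg ha _ _) (poissonKernel_nonneg hb _ _)
    have hmz : AEStronglyMeasurable (fun y => poissonKernel a x y * poissonKernel b y z)
        (gaussian d) := (hm0.mul (hm3 z)).aestronglyMeasurable
    constructor
    · refine ⟨hmz, ?_⟩
      rw [hasFiniteIntegral_iff_ofReal (Filter.Eventually.of_forall hnn), h1]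
      exact ENNReal.ofReal_lt_top
    · rw [integral_eq_lintegral_of_nonneg_ae (Filter.Eventually.of_forall hnn) hmz, h1,
        ENNReal.toReal_ofReal (poissonKernel_nonneg (add_pos ha hb) _ _)]
  simp_rw [← integral_const_mul]
  rw [integral_integral_swap]
  · refine integral_congr_ae (Filter.Eventually.of_forall fun z => ?_)
    simp only [← mul_assoc]
    rw [integral_mul_const, (e z).2]
  · have hmm : AEStronglyMeasurable (fun w : Space d × Space d =>
        poissonKernel a x w.1 * (poissonKernel b w.1 w.2 * f w.2))
        ((gaussian d).prod (gaussian d)) :=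
      hm1.aestronglyMeasurable.mul (hm2.aestronglyMeasurable.mul hf.aestronglyMeasurable.comp_snd)
    rw [integrable_prod_iff' (by exact hmm)]
    constructor
    · refine Filter.Eventually.of_forall fun z => ?_
      simp only [Function.uncurry, ← mul_assoc]
      exact (e z).1.mul_const _
    · have : (fun z => ∫ y, ‖Function.uncurry (fun y z => poissonKernel a x y *
          (poissonKernel b y z * f z)) (y, z)‖ ∂(gaussian d))
          = fun z => poissonKernel (a + b) x z * |f z| := by
        ext z
        rw [← (e z).2, ← integral_mul_const]
        refine integral_congr_ae (Filter.Eventually.of_forall fun y => ?_)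
        simp only [Function.uncurry, Real.norm_eq_abs]
        rw [abs_mul, abs_mul, abs_of_nonneg (poissonKernel_nonneg ha _ _),
          abs_of_nonneg (poissonKernel_nonneg hb _ _), mul_assoc]
      rw [this]
      exact integrable_poissonKernel_mul (add_pos ha hb) hf.abs x

lemma integrable_poissonDeriv {d : ℕ} {f : Space d → ℝ} (hf : Integrable f (gaussian d)) (k : ℕ)
    {t : ℝ} (ht : 0 < t) : Integrable (poissonDeriv k t f) (gaussian d) := by
  have hm2 : Measurable fun w : Space d × ℝ => ornsteinUhlenbeck w.2 f w.1 :=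
    measurable_ornsteinUhlenbeck hf.aestronglyMeasurable (by fun_prop) (by fun_prop)
  have hpos : ∀ᵐ w ∂((gaussian d).prod (volume.restrict (Set.Ioi (0 : ℝ)))), 0 < w.2 :=
    Measure.quasiMeasurePreserving_snd.ae ae_pos_Ioi
  have h := (hasDerivAt_integral_levy measurable_snd hpos hm2.aestronglyMeasurable
    (fun t ht => integrable_levy_mul_ou_prod hf ht) k ht).1
  refine h.integral_prod_left.congr (Filter.Eventually.of_forall fun y => ?_)
  exact (poissonDeriv_eq hf k ht y).symm

/-- The semigroup property, differentiated: `P_a (∂_b^k P_b f) = (∂^k P f)(a + b)`. -/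
lemma poissonHermite_poissonDeriv {d : ℕ} {f : Space d → ℝ} (hf : Integrable f (gaussian d))
    (k : ℕ) {a b : ℝ} (ha : 0 < a) (hb : 0 < b) (x : Space d) :
    poissonHermite a (poissonDeriv k b f) x = poissonDeriv k (a + b) f x := by
  have hm1 : Measurable fun w : Space d × ℝ => poissonKernel a x w.1 :=
    measurable_poissonKernel a (by fun_prop) (by fun_prop)
  have hm2 : Measurable fun w : Space d × ℝ => ornsteinUhlenbeck w.2 f w.1 :=
    measurable_ornsteinUhlenbeck hf.aestronglyMeasurable (by fun_prop) (by fun_prop)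
  have hpos : ∀ᵐ w ∂((gaussian d).prod (volume.restrict (Set.Ioi (0 : ℝ)))), 0 < w.2 :=
    Measure.quasiMeasurePreserving_snd.ae ae_pos_Ioi
  have hg : AEStronglyMeasurable (fun w : Space d × ℝ =>
      poissonKernel a x w.1 * ornsteinUhlenbeck w.2 f w.1)
      ((gaussian d).prod (volume.restrict (Set.Ioi (0 : ℝ)))) := (hm1.mul hm2).aestronglyMeasurable
  have h0 := fun t ht => integrable_levy_mul_kernel_mul_ou hf ha (t := t) ht x
  -- Fubini identifies the double integral at every order of differentiation.
  have hF : ∀ k t, 0 < t → ∫ w, levy k t w.2 * (poissonKernel a x w.1 *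
      ornsteinUhlenbeck w.2 f w.1) ∂((gaussian d).prod (volume.restrict (Set.Ioi (0 : ℝ))))
      = ∫ y, poissonKernel a x y * poissonDeriv k t f y ∂(gaussian d) := by
    intro k t ht
    rw [integral_prod _ (hasDerivAt_integral_levy measurable_snd hpos hg h0 k ht).1]
    refine integral_congr_ae (Filter.Eventually.of_forall fun y => ?_)
    simp only
    rw [poissonDeriv_eq hf k ht, ← integral_const_mul]
    refine integral_congr_ae (Filter.Eventually.of_forall fun s => ?_)
    simp only
    ring
  have h0' : ∀ t, 0 < t → ∫ w, levy 0 t w.2 * (poissonKernel a x w.1 *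
      ornsteinUhlenbeck w.2 f w.1) ∂((gaussian d).prod (volume.restrict (Set.Ioi (0 : ℝ))))
      = poissonHermite (a + t) f x := by
    intro t ht
    rw [hF 0 t ht, poissonHermite_eq_kernel (add_pos ha ht) hf,
      ← integral_kernel_mul_kernel ha ht hf x]
    refine integral_congr_ae (Filter.Eventually.of_forall fun y => ?_)
    simp only [poissonDeriv, iteratedDeriv_zero]
    rw [poissonHermite_eq_kernel ht hf]
  rw [poissonHermite_eq_kernel ha (integrable_poissonDeriv hf k hb), ← hF k b hb,
    ← iteratedDeriv_integral_levy measurable_snd hpos hg h0 k hb]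
  have e1 : iteratedDeriv k (fun t => ∫ w, levy 0 t w.2 * (poissonKernel a x w.1 *
      ornsteinUhlenbeck w.2 f w.1) ∂((gaussian d).prod (volume.restrict (Set.Ioi (0 : ℝ))))) b
      = iteratedDeriv k (fun t => poissonHermite (a + t) f x) b := by
    refine Filter.EventuallyEq.iteratedDeriv_eq k ?_
    filter_upwards [Ioi_mem_nhds hb] with t ht
    exact h0' t ht
  rw [e1, iteratedDeriv_comp_const_add (f := fun t => poissonHermite t f x)]
  rfl

lemma poissonDeriv_poissonDeriv {d : ℕ} {f : Space d → ℝ} (hf : Integrable f (gaussian d))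
    (j k : ℕ) {a b : ℝ} (ha : 0 < a) (hb : 0 < b) (x : Space d) :
    poissonDeriv j a (poissonDeriv k b f) x = poissonDeriv (j + k) (a + b) f x := by
  induction j generalizing a with
  | zero => simpa [poissonDeriv] using poissonHermite_poissonDeriv hf k ha hb x
  | succ j ih =>
    have h1 := (hasDerivAt_poissonDeriv (integrable_poissonDeriv hf k hb) j ha x).deriv
    have h2 := ((hasDerivAt_poissonDeriv hf (j + k) (add_pos ha hb) x).comp_add_const a b).deriv
    rw [← h1, show j + 1 + k = j + k + 1 by ring, ← h2]
    refine Filter.EventuallyEq.deriv_eq ?_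
    filter_upwards [Ioi_mem_nhds ha] with s hs
    exact ih hs

/-- Pointwise bound of a time derivative by the semigroup at half the time. -/
lemma exists_enorm_poissonDeriv_le (k : ℕ) : ∃ C : ℝ, 0 < C ∧ ∀ (d : ℕ) (f : Space d → ℝ),
    Integrable f (gaussian d) → ∀ t : ℝ, 0 < t → ∀ x, ‖poissonDeriv k t f x‖ₑ
      ≤ ENNReal.ofReal (C / t ^ k) * ∫⁻ s in Set.Ioi (0 : ℝ), ENNReal.ofReal (levy 0 (t / 2) s) *
        ∫⁻ y, ENNReal.ofReal (mehler s x y) * ‖f y‖ₑ ∂(gaussian d) := by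
  obtain ⟨C, hC, h⟩ := exists_abs_levy_le k
  refine ⟨C, hC, fun d f hf t ht x => ?_⟩
  rw [poissonDeriv_eq hf k ht, ← lintegral_const_mul' _ _ ENNReal.ofReal_ne_top]
  refine (enorm_integral_le_lintegral_enorm _).trans (setLIntegral_mono' measurableSet_Ioi
    fun s hs => ?_)
  have hs : 0 < s := hs
  rw [enorm_mul, ← mul_assoc]
  gcongr
  · rw [← ENNReal.ofReal_mul (by positivity), Real.enorm_eq_ofReal_abs]
    exact ENNReal.ofReal_le_ofReal (h t s ht hs)
  · rw [ornsteinUhlenbeck_eq]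
    refine (enorm_integral_le_lintegral_enorm _).trans (lintegral_mono fun z => ?_)
    rw [enorm_mul, Real.enorm_of_nonneg (mehler_pos hs x z).le]

/-- Pointwise decay of the time derivatives at infinity. -/
lemma exists_abs_poissonDeriv_le {d : ℕ} {f : Space d → ℝ} (hf : Integrable f (gaussian d))
    (k : ℕ) {t₀ : ℝ} (ht₀ : 0 < t₀) (x : Space d) :
    ∃ C, 0 ≤ C ∧ ∀ t, t₀ ≤ t → |poissonDeriv k t f x| ≤ C / t ^ k := by
  obtain ⟨C, hC, h⟩ := exists_abs_levy_le k
  obtain ⟨D, hD, h'⟩ := exists_levy_mul_mehlerConst_le d (half_pos ht₀)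
  set K := Real.exp (‖x‖ ^ 2) * ∫ y, |f y| ∂(gaussian d) with hK
  have hK0 : 0 ≤ K := mul_nonneg (Real.exp_pos _).le (integral_nonneg fun y => abs_nonneg _)
  refine ⟨C * D * K, by positivity, fun t ht => ?_⟩
  have ht0 : 0 < t := ht₀.trans_le ht
  have e : C * D * K / t ^ k
      = ∫ s in Set.Ioi (0 : ℝ), levy 0 (t / 2 / 2) s * (C * D * K / t ^ k) := by
    rw [integral_mul_const, integral_levy (by positivity), one_mul]
  rw [poissonDeriv_eq hf k ht0, e, ← Real.norm_eq_abs]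
  refine norm_integral_le_of_norm_le ((integrable_levy (by positivity)).mul_const _) ?_
  filter_upwards [ae_pos_Ioi] with s hs
  have h1 := levy_zero_pos (half_pos ht0) hs
  have h2 := mehlerConst_pos d hs
  rw [Real.norm_eq_abs, abs_mul]
  calc _ ≤ C / t ^ k * levy 0 (t / 2) s * (mehlerConst d s * K) := by
        gcongr
        · exact h t s ht0 hs
        · exact abs_ornsteinUhlenbeck_le hs hf x
    _ = C / t ^ k * (levy 0 (t / 2) s * mehlerConst d s) * K := by ring
    _ ≤ C / t ^ k * (D * levy 0 (t / 2 / 2) s) * K := by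
        have := h' (t / 2) s (by linarith) hs
        exact mul_le_mul_of_nonneg_right (mul_le_mul_of_nonneg_left this (by positivity)) hK0
    _ = _ := by ring

/-- For `n ≥ 1` the derivative of order `n` is recovered from the next one by integration over
`(t, ∞)`, since it vanishes at infinity. -/
lemma enorm_poissonDeriv_le_lintegral {d : ℕ} {f : Space d → ℝ} (hf : Integrable f (gaussian d))
    {n : ℕ} (hn : 1 ≤ n) {t : ℝ} (ht : 0 < t) (x : Space d) :
    ‖poissonDeriv n t f x‖ₑ ≤ ∫⁻ s in Set.Ioi t, ‖poissonDeriv (n + 1) s f x‖ₑ := by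
  obtain ⟨C, hC, h⟩ := exists_abs_poissonDeriv_le hf n ht x
  obtain ⟨D, hD, h'⟩ := exists_abs_poissonDeriv_le hf (n + 1) ht x
  have hlim : Filter.Tendsto (fun s => poissonDeriv n s f x) Filter.atTop (nhds 0) := by
    refine squeeze_zero_norm' (a := fun s => C / s ^ n) ?_ ?_
    · filter_upwards [Filter.eventually_ge_atTop t] with s hs
      exact h s hs
    · exact (Filter.tendsto_pow_atTop (by omega)).const_div_atTop C
  have hint : IntegrableOn (fun s => poissonDeriv (n + 1) s f x) (Set.Ioi t) := by
    have hI : IntegrableOn (fun s : ℝ => D * s ^ (-((n : ℝ) + 1))) (Set.Ioi t) := by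
      refine (integrableOn_Ioi_rpow_of_lt ?_ ht).const_mul D
      have : (1 : ℝ) ≤ n := by exact_mod_cast hn
      linarith
    refine hI.mono' ?_ ?_
    · have hm := measurable_integral_levy_mul_ou hf.aestronglyMeasurable (n + 1) measurable_id
        (measurable_const (a := x))
      refine hm.aestronglyMeasurable.congr ?_
      filter_upwards [ae_restrict_mem measurableSet_Ioi] with s hs
      exact (poissonDeriv_eq hf (n + 1) (ht.trans hs) x).symm
    · filter_upwards [ae_restrict_mem measurableSet_Ioi] with s hs
      have hs : t < s := hs
      refine (h' s hs.le).trans_eq ?_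
      rw [Real.rpow_neg (ht.trans hs).le, div_eq_mul_inv]
      congr 2
      exact_mod_cast (Real.rpow_natCast s (n + 1)).symm
  have hFTC := integral_Ioi_of_hasDerivAt_of_tendsto'
    (fun s (hs : t ≤ s) => hasDerivAt_poissonDeriv hf n (ht.trans_le hs) x) hint hlim
  rw [zero_sub] at hFTC
  rw [← enorm_neg, ← hFTC]
  exact enorm_integral_le_lintegral_enorm _

/-! ### The exponent along the Mehler kernel -/

lemma LocallyLogHolder.exists_le {d : ℕ} {p : Space d → ℝ} (h : LocallyLogHolder p) :
    ∃ M, 1 ≤ M ∧ ∀ x, p x ≤ M := by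
  obtain ⟨C, hC, h⟩ := h
  refine ⟨|p 0| + C + 1, by linarith [abs_nonneg (p 0)], fun x => ?_⟩
  have h1 : 1 ≤ Real.log (Real.exp 1 + 1 / ‖x - 0‖) := by
    rw [Real.le_log_iff_exp_le (by positivity)]
    have : 0 ≤ 1 / ‖x - 0‖ := by positivity
    linarith
  have h2 : C / Real.log (Real.exp 1 + 1 / ‖x - 0‖) ≤ C := div_le_self hC.le h1
  linarith [(le_abs_self _).trans (h x 0), le_abs_self (p 0)]

lemma mul_norm_sq_le_of_decay {d : ℕ} {p : Space d → ℝ} {K pinf a : ℝ} (hK : 0 < K) (ha : 0 ≤ a)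
    (h : ∀ x, x ≠ 0 → |p x - pinf| ≤ K / ‖x‖ ^ 2) {x y : Space d}
    (hxy : ‖x‖ ^ 2 ≤ a * ‖y‖ ^ 2) : (p x - p y) * ‖x‖ ^ 2 ≤ K * (1 + a) := by
  by_cases hx : x = 0
  · subst hx
    simp only [norm_zero]
    have : 0 ≤ K * (1 + a) := by positivity
    linarith
  have hx2 : 0 < ‖x‖ ^ 2 := by positivity
  have hy2 : 0 < ‖y‖ ^ 2 := by
    by_contra hc
    have : ‖y‖ ^ 2 = 0 := le_antisymm (not_lt.mp hc) (by positivity)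
    rw [this] at hxy
    linarith
  have hy : y ≠ 0 := by
    rintro rfl
    simp at hy2
  have h1 : |p x - pinf| * ‖x‖ ^ 2 ≤ K := (le_div_iff₀ hx2).mp (h x hx)
  have h2 : |p y - pinf| * ‖y‖ ^ 2 ≤ K := (le_div_iff₀ hy2).mp (h y hy)
  have h3 : |p y - pinf| * ‖x‖ ^ 2 ≤ K * a := by
    calc _ ≤ |p y - pinf| * (a * ‖y‖ ^ 2) := by gcongr
      _ = |p y - pinf| * ‖y‖ ^ 2 * a := by ring
      _ ≤ _ := by gcongr
  have h4 : p x - p y ≤ |p x - pinf| + |p y - pinf| := by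
    linarith [le_abs_self (p x - pinf), neg_abs_le (p y - pinf)]
  calc _ ≤ (|p x - pinf| + |p y - pinf|) * ‖x‖ ^ 2 := by gcongr
    _ ≤ _ := by rw [add_mul]; linarith

lemma inv_pow_mul_exp_neg_le {ρ : ℝ} (hρ : 0 < ρ) (n : ℕ) :
    (1 / ρ) ^ n * Real.exp (-(1 / ρ)) ≤ n.factorial := by
  have h := Real.pow_div_factorial_le_exp (1 / ρ) (by positivity) n
  rw [div_le_iff₀ (by positivity)] at h
  rw [Real.exp_neg, ← div_eq_mul_inv, div_le_iff₀ (Real.exp_pos _)]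
  linarith

/-- When `x - q y` is not small the exponent of a nearly singular Mehler kernel is very negative:
the case of large `x` and comparatively small `y`. -/
lemma sub_norm_sq_div_le_of_norm_le {d : ℕ} {ρ q : ℝ} (hρ0 : 0 < ρ) (hρ8 : ρ < 1 / 8) (hq0 : 0 ≤ q)
    (hq1 : q ≤ 1) {x y : Space d} (hNρ : 1 / ρ ≤ ‖x‖ ^ 2) (hy3 : ‖y‖ ≤ 3 / 4 * ‖x‖) :
    ‖x‖ ^ 2 - ‖x - q • y‖ ^ 2 / ρ ^ 4 ≤ -(1 / ρ) := by
  have h1 : 1 / 4 * ‖x‖ ≤ ‖x - q • y‖ := by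
    have h2 := norm_sub_norm_le x (q • y)
    rw [norm_smul, Real.norm_eq_abs, abs_of_nonneg hq0] at h2
    have h3 : q * ‖y‖ ≤ 1 * ‖y‖ := by gcongr
    linarith
  have h2 : ‖x‖ ^ 2 / 16 ≤ ‖x - q • y‖ ^ 2 := by
    calc ‖x‖ ^ 2 / 16 = (1 / 4 * ‖x‖) ^ 2 := by rw [mul_pow]; norm_num; ring
      _ ≤ _ := by gcongr
  have h3 : 2 * ‖x‖ ^ 2 ≤ ‖x‖ ^ 2 / 16 / ρ ^ 4 := by
    rw [le_div_iff₀ (by positivity)]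
    have : ρ ^ 4 ≤ (1 / 8) ^ 4 := by gcongr
    nlinarith
  have h4 : ‖x‖ ^ 2 / 16 / ρ ^ 4 ≤ ‖x - q • y‖ ^ 2 / ρ ^ 4 := by gcongr
  linarith

/-- When `x - q y` is not small the exponent of a nearly singular Mehler kernel is very negative:
the case of moderate `x`. -/
lemma sub_norm_sq_div_le_of_lt_norm_sub {d : ℕ} {ρ q : ℝ} (hρ0 : 0 < ρ) (hρ8 : ρ < 1 / 8)
    (hq0 : 0 < q) (hq1 : q < 1) (hq2 : q ^ 2 = 1 - ρ ^ 4) {x y : Space d} (hNρ : ‖x‖ ^ 2 < 1 / ρ)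
    (hxy : ρ < ‖x - y‖) :
    ‖x‖ ^ 2 - ‖x - q • y‖ ^ 2 / ρ ^ 4 ≤ -(1 / ρ) := by
  have hx : ‖x‖ ≤ 1 / ρ := by
    refine abs_le_of_sq_le_sq' ?_ (by positivity) |>.2
    have : 1 ≤ 1 / ρ := by rw [le_div_iff₀ hρ0]; linarith
    nlinarith
  have hq3 : 1 - q ≤ ρ ^ 4 := by nlinarith
  have h1 : ρ / 2 ≤ ‖x - q • y‖ := by
    have e : x - q • y = q • (x - y) - (-(1 - q)) • x := by
      module
    have h2 := norm_sub_norm_le (q • (x - y)) ((-(1 - q)) • x)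
    rw [← e, norm_smul, norm_smul, Real.norm_eq_abs, Real.norm_eq_abs, abs_of_pos hq0, abs_neg,
      abs_of_pos (by linarith)] at h2
    have h3 : (1 - q) * ‖x‖ ≤ ρ ^ 3 := by
      calc _ ≤ ρ ^ 4 * (1 / ρ) := by gcongr
        _ = _ := by field_simp
    have h4 : (1 - ρ ^ 4) * ρ ≤ q * ‖x - y‖ := by
      gcongr
      linarith
    have h5 : ρ ^ 2 ≤ (1 / 8) ^ 2 := by gcongr
    have h6 : ρ ^ 4 ≤ (1 / 8) ^ 4 := by gcongr
    have h7 : ρ ^ 3 ≤ ρ * (1 / 8) ^ 2 := by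
      calc ρ ^ 3 = ρ * ρ ^ 2 := by ring
        _ ≤ _ := by gcongr
    have h8 : (1 - (1 / 8) ^ 4) * ρ ≤ (1 - ρ ^ 4) * ρ := by gcongr
    linarith
  have h2 : (ρ / 2) ^ 2 / ρ ^ 4 ≤ ‖x - q • y‖ ^ 2 / ρ ^ 4 := by gcongr
  have h3 : 2 * (1 / ρ) ≤ (ρ / 2) ^ 2 / ρ ^ 4 := by
    rw [le_div_iff₀ (by positivity)]
    have : 2 * (1 / ρ) * ρ ^ 4 = 2 * ρ * ρ ^ 2 := by field_simp
    rw [this]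
    nlinarith [sq_nonneg ρ]
  linarith

/-- The dichotomy behind the boundedness of the Ornstein-Uhlenbeck semigroup on variable Lebesgue
spaces. With `B = (1 - e^{-2s})^{-d/2} e^{|x|²}` the maximum of the Mehler kernel at `x`, either
`B^{p(x) - p(y)}` is bounded, or the Mehler kernel at `(x, y)` is so small that its `p(x)`-th power
is integrable for `γ_d`. The decay of `p` controls the factor `e^{|x|²}` and, for large `x`, the
singular factor as well; the log-Hölder condition is needed for the singular factor when `x` is
not large and `y` is close to `x`. -/
lemma exists_mehler_dichotomy {d : ℕ} {p : Space d → ℝ} (hp : GaussianDecay p)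
    (hLH : LocallyLogHolder p) {M : ℝ} (hM1 : 1 ≤ M) (hM : ∀ x, p x ≤ M) :
    ∃ C, 1 ≤ C ∧ ∀ s, 0 < s → ∀ x y : Space d,
      (p x - p y) * Real.log (mehlerConst d s * Real.exp (‖x‖ ^ 2)) ≤ C ∨
        mehler s x y ≤ C * Real.exp (‖x‖ ^ 2 / (2 * M)) := by
  obtain ⟨⟨-, hp1⟩, K, pinf, hK, -, hdec⟩ := hp
  obtain ⟨C₁, hC₁, hlog⟩ := hLH
  set n := 2 * d with hn
  have hn0 : (0 : ℝ) ≤ n := Nat.cast_nonneg n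
  set K' := K * (1 + 2 * M) with hK'
  have hK'0 : 0 < K' := by positivity
  set C := 1 + n * (7 * M) + (n + 1) * K' + 8 ^ n + n.factorial + n * C₁ + 4 * M + K * (1 + 4)
    with hC
  have t1 : 0 ≤ n * (7 * M) := by positivity
  have t2 : 0 ≤ (n + 1) * K' := by positivity
  have t3 : (0 : ℝ) ≤ 8 ^ n := by positivity
  have t4 : (0 : ℝ) ≤ n.factorial := by positivity
  have t5 : 0 ≤ n * C₁ := by positivity
  have t6 : 0 ≤ 4 * M := by positivity
  have t7 : 0 ≤ K * (1 + 4) := by positivity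
  have hC1 : 1 ≤ C := by linarith
  refine ⟨C, hC1, fun s hs x y => ?_⟩
  have hR0 := ouVar_pos hs
  have hR1 := ouVar_lt_one s
  -- The parameter `ρ = (1 - e^{-2s})^{1/4}` makes all the powers below integral.
  set ρ := Real.sqrt (Real.sqrt (ouVar s)) with hρd
  have hρ0 : 0 < ρ := Real.sqrt_pos.mpr (Real.sqrt_pos.mpr hR0)
  have hρ4 : ρ ^ 4 = ouVar s := by
    rw [show ρ ^ 4 = (ρ ^ 2) ^ 2 by ring, hρd, Real.sq_sqrt (Real.sqrt_nonneg _),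
      Real.sq_sqrt hR0.le]
  have hρ1 : ρ < 1 := by
    by_contra hc
    have : 1 ≤ ρ ^ 4 := one_le_pow₀ (not_lt.mp hc)
    linarith
  have hmc : mehlerConst d s = (1 / ρ) ^ n := by
    rw [mehlerConst, ← hρ4, div_pow, one_pow, hn, ← Real.rpow_natCast ρ 4, ← Real.rpow_mul hρ0.le,
      ← Real.rpow_natCast]
    congr 2
    push_cast
    ring
  have hL0 : 0 ≤ Real.log (1 / ρ) := Real.log_nonneg (by rw [le_div_iff₀ hρ0]; linarith)
  set N := ‖x‖ ^ 2 with hN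
  have hN0 : 0 ≤ N := by positivity
  have hlogB : Real.log (mehlerConst d s * Real.exp N) = n * Real.log (1 / ρ) + N := by
    rw [hmc, Real.log_mul (by positivity) (Real.exp_pos _).ne', Real.log_pow, Real.log_exp]
  rw [hlogB]
  rcases le_or_gt (p x) (p y) with hpxy | hpxy
  · left
    have : (p x - p y) * (n * Real.log (1 / ρ) + N) ≤ 0 :=
      mul_nonpos_of_nonpos_of_nonneg (by linarith) (by positivity)
    linarith
  have hδ0 : 0 < p x - p y := by linarith
  have hδM : p x - p y ≤ M := by linarith [hM x, hp1 y]
  have hexp1 : 1 ≤ Real.exp (N / (2 * M)) := Real.one_le_exp (by positivity)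
  -- In the singular regime it is enough to have `exp (-1/ρ)` in the kernel.
  have hsmall : ∀ E, E ≤ -(1 / ρ) → mehler s x y = (1 / ρ) ^ n * Real.exp E →
      mehler s x y ≤ C * Real.exp (N / (2 * M)) := by
    intro E hE he
    calc mehler s x y = (1 / ρ) ^ n * Real.exp E := he
      _ ≤ (1 / ρ) ^ n * Real.exp (-(1 / ρ)) := by gcongr
      _ ≤ n.factorial := inv_pow_mul_exp_neg_le hρ0 n
      _ ≤ C * 1 := by linarith
      _ ≤ _ := by gcongr
  have hmeh : mehler s x y = (1 / ρ) ^ n * Real.exp (N - ‖x - Real.exp (-s) • y‖ ^ 2 / ρ ^ 4) := by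
    rw [← hmc, hρ4]; exact mehler_eq_exp_sub hs x y
  have hq0 := Real.exp_pos (-s)
  have hq1 : Real.exp (-s) < 1 := Real.exp_lt_one_iff.mpr (by linarith)
  have hq2 : Real.exp (-s) ^ 2 = 1 - ρ ^ 4 := by rw [hρ4]; exact exp_neg_sq_eq s
  -- The kernel has no singular factor when `ρ ≥ 1/8`.
  rcases le_or_gt (1 / 8) ρ with hρ8 | hρ8
  · have hL : Real.log (1 / ρ) ≤ 7 := by
      have h1 := Real.log_le_sub_one_of_pos (show 0 < 1 / ρ by positivity)
      have h2 : 1 / ρ ≤ 8 := by rw [div_le_iff₀ hρ0]; linarith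
      linarith
    rcases le_or_gt N (2 * M * ‖y‖ ^ 2) with hy | hy
    · left
      have h1 := mul_norm_sq_le_of_decay hK (by positivity) hdec hy
      have h2 : (p x - p y) * (n * Real.log (1 / ρ)) ≤ n * (7 * M) := by
        calc _ = n * (Real.log (1 / ρ) * (p x - p y)) := by ring
          _ ≤ _ := by gcongr
      have h3 : 0 ≤ n * K' := by positivity
      rw [mul_add]
      linarith
    · right
      calc mehler s x y ≤ (1 / ρ) ^ n * Real.exp (‖y‖ ^ 2) := by
            rw [mehler_comm, ← hmc]; exact mehler_le hs y x
        _ ≤ 8 ^ n * Real.exp (N / (2 * M)) := by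
            gcongr
            · rw [div_le_iff₀ hρ0]; linarith
            · rw [le_div_iff₀ (by positivity)]; linarith
        _ ≤ _ := by gcongr; linarith
  -- For `|x|² ≥ 1/ρ` the decay of `p` absorbs `log (1/ρ) ≤ |x|²` as well.
  rcases le_or_gt (1 / ρ) N with hNρ | hNρ
  · rcases le_or_gt N (2 * M * ‖y‖ ^ 2) with hy | hy
    · left
      have h1 := mul_norm_sq_le_of_decay hK (by positivity) hdec hy
      have h2 : (p x - p y) * (n * Real.log (1 / ρ)) ≤ n * K' := by
        have := Real.log_le_sub_one_of_pos (show 0 < 1 / ρ by positivity)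
        calc _ ≤ (p x - p y) * (n * N) := by gcongr; linarith
          _ = n * ((p x - p y) * N) := by ring
          _ ≤ _ := by gcongr
      rw [mul_add]
      linarith
    · right
      refine hsmall _ ?_ hmeh
      have hy2 : 2 * ‖y‖ ^ 2 ≤ N := by nlinarith [sq_nonneg ‖y‖]
      have hy3 : ‖y‖ ≤ 3 / 4 * ‖x‖ := by
        refine abs_le_of_sq_le_sq' ?_ (by positivity) |>.2
        rw [mul_pow]
        linarith
      exact sub_norm_sq_div_le_of_norm_le hρ0 hρ8 hq0.le hq1.le hNρ hy3
  · rcases le_or_gt ‖x - y‖ ρ with hxy | hxy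
    · left
      have hne : 0 < ‖x - y‖ := by
        rw [norm_pos_iff, sub_ne_zero]
        rintro rfl
        exact lt_irrefl _ hpxy
      have h1 : (p x - p y) * Real.log (1 / ρ) ≤ C₁ := by
        have h2 : Real.log (1 / ρ) ≤ Real.log (Real.exp 1 + 1 / ‖x - y‖) := by
          apply Real.log_le_log (by positivity)
          have : 1 / ρ ≤ 1 / ‖x - y‖ := by gcongr
          linarith [Real.exp_pos 1]
        have h3 : 1 ≤ Real.log (Real.exp 1 + 1 / ‖x - y‖) := by
          rw [Real.le_log_iff_exp_le (by positivity)]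
          have : 0 ≤ 1 / ‖x - y‖ := by positivity
          linarith
        calc _ ≤ (p x - p y) * Real.log (Real.exp 1 + 1 / ‖x - y‖) := by gcongr
          _ ≤ C₁ := by
            rw [← le_div_iff₀ (by linarith)]
            exact (le_abs_self _).trans (hlog x y)
      have h2 : (p x - p y) * (n * Real.log (1 / ρ)) ≤ n * C₁ := by
        calc _ = n * ((p x - p y) * Real.log (1 / ρ)) := by ring
          _ ≤ _ := by gcongr
      have h3 : (p x - p y) * N ≤ 4 * M + K * (1 + 4) := by
        rcases le_or_gt N 4 with h4 | h4
        · calc _ ≤ M * 4 := by gcongr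
            _ ≤ _ := by linarith
        · have h5 : 2 < ‖x‖ := by
            refine lt_of_pow_lt_pow_left₀ 2 (norm_nonneg _) ?_
            linarith
          have h6 : ‖x‖ ≤ 2 * ‖y‖ := by
            have := norm_sub_norm_le x y
            linarith
          have h7 : N ≤ 4 * ‖y‖ ^ 2 := by
            calc N ≤ (2 * ‖y‖) ^ 2 := by rw [hN]; gcongr
              _ = _ := by ring
          have := mul_norm_sq_le_of_decay hK (by norm_num) hdec h7
          linarith
      rw [mul_add]
      linarith
    · right
      refine hsmall _ ?_ hmeh
      exact sub_norm_sq_div_le_of_lt_norm_sub hρ0 hρ8 hq0 hq1 hq2 hNρ hxy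

/-! ### Uniform boundedness on variable Lebesgue spaces -/

/-- Jensen's inequality for a power and a probability density. -/
lemma lintegral_mul_rpow_le {Ω : Type*} [MeasurableSpace Ω] {μ : Measure Ω} {w F : Ω → ℝ≥0∞}
    (hw : Measurable w) (hw1 : ∫⁻ ω, w ω ∂μ = 1) (hF : Measurable F) {q : ℝ} (hq : 1 ≤ q) :
    (∫⁻ ω, w ω * F ω ∂μ) ^ q ≤ ∫⁻ ω, w ω * F ω ^ q ∂μ := by
  rcases hq.eq_or_lt with rfl | hq1
  · simp
  have hν : ∀ {G : Ω → ℝ≥0∞}, Measurable G →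
      ∫⁻ ω, G ω ∂(μ.withDensity w) = ∫⁻ ω, w ω * G ω ∂μ := fun hG =>
    lintegral_withDensity_eq_lintegral_mul μ hw hG
  have hone : ∫⁻ _, 1 ∂(μ.withDensity w) = 1 := by
    rw [hν measurable_const]; simpa using hw1
  have h := ENNReal.lintegral_mul_le_Lp_mul_Lq (μ.withDensity w)
    (Real.HolderConjugate.conjExponent hq1) hF.aemeasurable (g := fun _ => 1) aemeasurable_const
  simp only [Pi.mul_apply, mul_one, ENNReal.one_rpow, hone] at h
  rw [← hν hF, ← hν (hF.pow_const q)]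
  calc _ ≤ ((∫⁻ ω, F ω ^ q ∂(μ.withDensity w)) ^ (1 / q)) ^ q := by gcongr
    _ = _ := by
      rw [← ENNReal.rpow_mul, one_div_mul_cancel (by linarith), ENNReal.rpow_one]

lemma add_rpow_le_two_mul {a b q : ℝ} (ha : 0 ≤ a) (hb : 0 ≤ b) (hq : 0 ≤ q) :
    (a + b) ^ q ≤ (2 * a) ^ q + (2 * b) ^ q := by
  have h1 : 0 ≤ (2 * a) ^ q := by positivity
  have h2 : 0 ≤ (2 * b) ^ q := by positivity
  rcases le_total a b with h | h
  · have := Real.rpow_le_rpow (by positivity) (show a + b ≤ 2 * b by linarith) hq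
    linarith
  · have := Real.rpow_le_rpow (by positivity) (show a + b ≤ 2 * a by linarith) hq
    linarith

/-- The value `u` of a function with exponent `q` is compared with the level `l^{1/P}`, for the
exponent `P` of another point. -/
lemma le_rpow_mul_of_log_le {P q C l u : ℝ} (hP : 1 ≤ P) (hq : 1 ≤ q) (hl : 1 ≤ l) (hu : 0 ≤ u)
    (hC : 0 ≤ C) (h : (P - q) * Real.log l ≤ C) :
    u ≤ l ^ (1 / P) * (1 + Real.exp C / l * u ^ q) := by
  have hl0 : 0 < l := by linarith
  have hP0 : 0 < P := by linarith
  have hL : 0 < l ^ (1 / P) := by positivity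
  rcases le_or_gt u (l ^ (1 / P)) with h1 | h1
  · calc u ≤ l ^ (1 / P) * 1 := by linarith
      _ ≤ _ := by
        gcongr
        have : 0 ≤ Real.exp C / l * u ^ q := by positivity
        linarith
  · have hu0 : 0 < u := hL.trans h1
    have e1 : u = u ^ q * u ^ (1 - q) := by
      rw [← Real.rpow_add hu0]; simp
    have e2 : u ^ (1 - q) ≤ (l ^ (1 / P)) ^ (1 - q) :=
      Real.rpow_le_rpow_of_nonpos hL h1.le (by linarith)
    have e3 : (l ^ (1 / P)) ^ (1 - q) = l ^ (1 / P) / l * l ^ ((P - q) / P) := by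
      rw [← Real.rpow_mul hl0.le, div_mul_eq_mul_div (l ^ (1 / P)), ← Real.rpow_add hl0,
        eq_div_iff hl0.ne', ← Real.rpow_add_one hl0.ne']
      congr 1
      field_simp
      ring
    have e4 : l ^ ((P - q) / P) ≤ Real.exp C := by
      rw [Real.rpow_def_of_pos hl0]
      gcongr
      rw [mul_div_assoc', div_le_iff₀ hP0, mul_comm]
      calc _ ≤ C * 1 := by linarith
        _ ≤ _ := by gcongr
    calc u = u ^ q * u ^ (1 - q) := e1
      _ ≤ u ^ q * (l ^ (1 / P) / l * Real.exp C) := by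
        rw [e3] at e2
        gcongr
        exact e2.trans (by gcongr)
      _ = l ^ (1 / P) * (0 + Real.exp C / l * u ^ q) := by ring
      _ ≤ _ := by gcongr; norm_num

lemma le_one_add_rpow {u q : ℝ} (hu : 0 ≤ u) (hq : 1 ≤ q) : u ≤ 1 + u ^ q := by
  have h0 : 0 ≤ u ^ q := by positivity
  rcases le_total u 1 with h | h
  · linarith
  · have := Real.rpow_le_rpow_of_exponent_le h hq
    rw [Real.rpow_one] at this
    linarith

lemma aemeasurable_modular_integrand {d : ℕ} {p f : Space d → ℝ} (hp : IsExponent p)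
    (hf : AEMeasurable f (gaussian d)) :
    AEMeasurable (fun x => ENNReal.ofReal (|f x| ^ p x)) (gaussian d) :=
  ((continuous_abs.measurable.comp_aemeasurable hf).pow hp.aemeasurable).ennreal_ofReal

lemma one_le_mehlerConst_mul (d : ℕ) {s : ℝ} (hs : 0 < s) (N : ℝ) (hN : 0 ≤ N) :
    1 ≤ mehlerConst d s * Real.exp N := by
  have h0 := ouVar_pos hs
  have h1 := ouVar_lt_one s
  have h2 : ouVar s ^ ((d : ℝ) / 2) ≤ 1 := Real.rpow_le_one h0.le h1.le (by positivity)
  have h3 : 1 ≤ mehlerConst d s := by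
    rw [mehlerConst, le_div_iff₀ (by positivity)]; linarith
  have h4 := Real.one_le_exp hN
  nlinarith

/-- Pointwise estimate of the `p(x)`-th power of the Ornstein-Uhlenbeck semigroup by the semigroup
applied to `|f|^{p(·)}`, up to an integrable error. -/
lemma exists_lintegral_mehler_rpow_le {d : ℕ} {p : Space d → ℝ} (hp : GaussianDecay p)
    (hLH : LocallyLogHolder p) :
    ∃ C : ℝ, 1 ≤ C ∧ ∀ s, 0 < s → ∀ f : Space d → ℝ, AEMeasurable f (gaussian d) →
      modular p f ≤ 1 → ∀ x,
      (∫⁻ y, ENNReal.ofReal (mehler s x y) * ‖f y‖ₑ ∂(gaussian d)) ^ p x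
        ≤ ENNReal.ofReal C * (1 + ∫⁻ y, ENNReal.ofReal (mehler s x y) *
            ENNReal.ofReal (|f y| ^ p y) ∂(gaussian d))
          + ENNReal.ofReal C * ENNReal.ofReal (Real.exp (‖x‖ ^ 2 / 2)) := by
  obtain ⟨M, hM1, hM⟩ := hLH.exists_le
  obtain ⟨C, hC1, hdich⟩ := exists_mehler_dichotomy hp hLH hM1 hM
  have hp1 := hp.1.one_le
  set E := Real.exp C with hE
  have hE0 : 1 ≤ E := Real.one_le_exp (by linarith)
  set D := (2 * (2 + E)) ^ M + (2 * C) ^ M with hD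
  have hD1 : 1 ≤ D := by
    have h1 : 1 ≤ (2 * (2 + E)) ^ M := Real.one_le_rpow (by linarith) (by linarith)
    have h2 : 0 ≤ (2 * C) ^ M := by positivity
    linarith
  refine ⟨D, hD1, fun s hs f hf hmod x => ?_⟩
  have hme := aemeasurable_modular_integrand hp.1 hf
  have hmehm : Measurable fun y : Space d => mehler s x y :=
    measurable_mehler (by fun_prop) (by fun_prop) (by fun_prop)
  set N := ‖x‖ ^ 2 with hN
  have hN0 : 0 ≤ N := by positivity
  set B := mehlerConst d s * Real.exp N with hB
  have hB1 : 1 ≤ B := one_le_mehlerConst_mul d hs N hN0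
  set A := ∫⁻ y, ENNReal.ofReal (mehler s x y) * ENNReal.ofReal (|f y| ^ p y) ∂(gaussian d) with hA
  have hAB : A ≤ ENNReal.ofReal B := by
    calc A ≤ ∫⁻ y, ENNReal.ofReal B * ENNReal.ofReal (|f y| ^ p y) ∂(gaussian d) := by
          refine lintegral_mono fun y => ?_
          gcongr
          exact mehler_le hs x y
      _ = ENNReal.ofReal B * modular p f := by
          rw [lintegral_const_mul' _ _ ENNReal.ofReal_ne_top, modular]
      _ ≤ ENNReal.ofReal B * 1 := by gcongr
      _ = _ := mul_one _
  have hAtop : A ≠ ∞ := ne_top_of_le_ne_top ENNReal.ofReal_ne_top hAB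
  have hAB' : A.toReal ≤ B := ENNReal.toReal_le_of_le_ofReal (by linarith) hAB
  -- The level to which the values of `f` are compared is `l^{1/p(x)}`.
  set l := max 1 A.toReal with hl
  have hl1 : 1 ≤ l := le_max_left _ _
  have hl0 : 0 < l := by linarith
  have hlB : l ≤ B := max_le hB1 hAB'
  have hAl : A ≤ ENNReal.ofReal l := by
    rw [← ENNReal.ofReal_toReal hAtop]
    exact ENNReal.ofReal_le_ofReal (le_max_right _ _)
  set P := p x with hP
  have hP1 : 1 ≤ P := hp1 x
  have hPM : P ≤ M := hM x
  set L := l ^ (1 / P) with hL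
  have hL0 : 0 < L := by positivity
  have hL1 : 1 ≤ L := Real.one_le_rpow hl1 (by positivity)
  set X := Real.exp (N / (2 * M)) with hX
  have hX0 : 0 < X := Real.exp_pos _
  have hpt : ∀ y, mehler s x y * |f y|
      ≤ (L + 1) * mehler s x y + L * (E / l) * (mehler s x y * |f y| ^ p y)
        + C * X * |f y| ^ p y := by
    intro y
    have hm0 := mehler_pos hs x y
    have hf0 : 0 ≤ |f y| ^ p y := by positivity
    -- In the first alternative `f(y)` is compared with the level, in the second with `1`.
    rcases hdich s hs x y with h | h
    · have h1 : (P - p y) * Real.log l ≤ C := by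
        rcases le_or_gt P (p y) with h2 | h2
        · have := mul_nonpos_of_nonpos_of_nonneg (show P - p y ≤ 0 by linarith)
            (Real.log_nonneg hl1)
          linarith
        · refine le_trans ?_ h
          have : 0 ≤ P - p y := by linarith
          gcongr
      have h2 := le_rpow_mul_of_log_le hP1 (hp1 y) hl1 (abs_nonneg (f y)) (by linarith) h1
      calc mehler s x y * |f y| ≤ mehler s x y * (L * (1 + E / l * |f y| ^ p y)) := by gcongr
        _ = L * mehler s x y + L * (E / l) * (mehler s x y * |f y| ^ p y) := by ring
        _ ≤ _ := by
          have : 0 ≤ C * X * |f y| ^ p y := by positivity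
          linarith
    · have h2 := le_one_add_rpow (abs_nonneg (f y)) (hp1 y)
      have h3 : mehler s x y * |f y| ^ p y ≤ C * X * |f y| ^ p y := by gcongr
      calc mehler s x y * |f y| ≤ mehler s x y * (1 + |f y| ^ p y) := by gcongr
        _ = mehler s x y + mehler s x y * |f y| ^ p y := by ring
        _ ≤ _ := by
          have : 0 ≤ L * mehler s x y := by positivity
          have : 0 ≤ L * (E / l) * (mehler s x y * |f y| ^ p y) := by positivity
          linarith
  have hTF : ∫⁻ y, ENNReal.ofReal (mehler s x y) * ‖f y‖ₑ ∂(gaussian d)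
      ≤ ENNReal.ofReal ((2 + E) * L + C * X) := by
    calc _ ≤ ∫⁻ y, (ENNReal.ofReal (L + 1) * ENNReal.ofReal (mehler s x y)
          + ENNReal.ofReal (L * (E / l)) * (ENNReal.ofReal (mehler s x y) *
              ENNReal.ofReal (|f y| ^ p y))
          + ENNReal.ofReal (C * X) * ENNReal.ofReal (|f y| ^ p y)) ∂(gaussian d) := by
          refine lintegral_mono fun y => ?_
          have hm0 := mehler_pos hs x y
          rw [Real.enorm_eq_ofReal_abs, ← ENNReal.ofReal_mul hm0.le, ← ENNReal.ofReal_mul hm0.le,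
            ← ENNReal.ofReal_mul (by positivity), ← ENNReal.ofReal_mul (by positivity),
            ← ENNReal.ofReal_mul (by positivity),
            ← ENNReal.ofReal_add (by positivity) (by positivity),
            ← ENNReal.ofReal_add (by positivity) (by positivity)]
          exact ENNReal.ofReal_le_ofReal (hpt y)
      _ = ENNReal.ofReal (L + 1) + ENNReal.ofReal (L * (E / l)) * A
          + ENNReal.ofReal (C * X) * modular p f := by
          rw [lintegral_add_right' _ (hme.const_mul _), lintegral_add_left (by fun_prop),
            lintegral_const_mul _ (by fun_prop), lintegral_mehler hs, mul_one,
            lintegral_const_mul' _ _ ENNReal.ofReal_ne_top,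
            lintegral_const_mul' _ _ ENNReal.ofReal_ne_top, modular]
      _ ≤ ENNReal.ofReal (L + 1) + ENNReal.ofReal (L * (E / l)) * ENNReal.ofReal l
          + ENNReal.ofReal (C * X) * 1 := by gcongr
      _ = ENNReal.ofReal (L + 1 + L * E + C * X) := by
          rw [mul_one, ← ENNReal.ofReal_mul (by positivity),
            ← ENNReal.ofReal_add (by positivity) (by positivity),
            ← ENNReal.ofReal_add (by positivity) (by positivity)]
          congr 3
          field_simp
      _ ≤ _ := by
          apply ENNReal.ofReal_le_ofReal
          linarith
  have hpow : ((2 + E) * L + C * X) ^ P ≤ D * l + D * Real.exp (N / 2) := by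
    have h1 : (2 * ((2 + E) * L)) ^ P ≤ D * l := by
      rw [← mul_assoc, Real.mul_rpow (by positivity) hL0.le, hL, ← Real.rpow_mul hl0.le,
        one_div_mul_cancel (by positivity), Real.rpow_one]
      gcongr
      have h2 : (2 * (2 + E)) ^ P ≤ (2 * (2 + E)) ^ M :=
        Real.rpow_le_rpow_of_exponent_le (by linarith) hPM
      have h3 : 0 ≤ (2 * C) ^ M := by positivity
      linarith
    have h2 : (2 * (C * X)) ^ P ≤ D * Real.exp (N / 2) := by
      rw [← mul_assoc, Real.mul_rpow (by positivity) hX0.le, hX, ← Real.exp_mul]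
      gcongr
      · have h2 : (2 * C) ^ P ≤ (2 * C) ^ M :=
          Real.rpow_le_rpow_of_exponent_le (by linarith) hPM
        have h3 : 0 ≤ (2 * (2 + E)) ^ M := by positivity
        linarith
      · calc N / (2 * M) * P ≤ N / (2 * M) * M := by gcongr
          _ = N / 2 := by field_simp
    exact (add_rpow_le_two_mul (by positivity) (by positivity) (by linarith)).trans
      (add_le_add h1 h2)
  calc _ ≤ (ENNReal.ofReal ((2 + E) * L + C * X)) ^ P := by gcongr
    _ = ENNReal.ofReal (((2 + E) * L + C * X) ^ P) :=
        ENNReal.ofReal_rpow_of_nonneg (by positivity) (by linarith)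
    _ ≤ ENNReal.ofReal (D * l + D * Real.exp (N / 2)) := ENNReal.ofReal_le_ofReal hpow
    _ = ENNReal.ofReal D * ENNReal.ofReal l
          + ENNReal.ofReal D * ENNReal.ofReal (Real.exp (N / 2)) := by
        rw [ENNReal.ofReal_add (by positivity) (by positivity), ENNReal.ofReal_mul (by linarith),
          ENNReal.ofReal_mul (by linarith)]
    _ ≤ _ := by
        have : ENNReal.ofReal l ≤ 1 + A := by
          rw [← ENNReal.ofReal_toReal hAtop, ← ENNReal.ofReal_one,
            ← ENNReal.ofReal_add zero_le_one ENNReal.toReal_nonneg]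
          apply ENNReal.ofReal_le_ofReal
          exact max_le (by linarith [ENNReal.toReal_nonneg (a := A)]) (by linarith)
        gcongr

/-- The Ornstein-Uhlenbeck semigroup is bounded on `L^{p(·)}(γ_d)`, uniformly in time. -/
lemma exists_lintegral_ou_rpow_le {d : ℕ} {p : Space d → ℝ} (hp : GaussianDecay p)
    (hLH : LocallyLogHolder p) :
    ∃ C : ℝ, 1 ≤ C ∧ ∀ s, 0 < s → ∀ f : Space d → ℝ, AEMeasurable f (gaussian d) →
      modular p f ≤ 1 →
      ∫⁻ x, (∫⁻ y, ENNReal.ofReal (mehler s x y) * ‖f y‖ₑ ∂(gaussian d)) ^ p x ∂(gaussian d)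
        ≤ ENNReal.ofReal C := by
  obtain ⟨C, hC1, h⟩ := exists_lintegral_mehler_rpow_le hp hLH
  have hexp : ∫⁻ x : Space d, ENNReal.ofReal (Real.exp (‖x‖ ^ 2 / 2)) ∂(gaussian d)
      = ENNReal.ofReal (2 ^ ((d : ℝ) / 2)) := by
    have h1 := lintegral_exp_quadratic_gaussian (d := d) (c := -(1 / 2)) (by norm_num) 0
    have e : ∀ x : Space d, -(-(1 / 2)) * ‖x‖ ^ 2 + inner ℝ 0 x = ‖x‖ ^ 2 / 2 := by
      intro x; rw [inner_zero_left]; ring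
    simp_rw [e] at h1
    rw [h1]
    norm_num
  have h2 : (1 : ℝ) ≤ 2 ^ ((d : ℝ) / 2) := Real.one_le_rpow (by norm_num) (by positivity)
  refine ⟨C * 2 + C * 2 ^ ((d : ℝ) / 2), by nlinarith, fun s hs f hf hmod => ?_⟩
  have hme := aemeasurable_modular_integrand hp.1 hf
  have hm : Measurable fun x : Space d =>
      ENNReal.ofReal C * ENNReal.ofReal (Real.exp (‖x‖ ^ 2 / 2)) := by fun_prop
  calc _ ≤ _ := lintegral_mono fun x => h s hs f hf hmod x
    _ = ENNReal.ofReal C * (1 + modular p f)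
        + ENNReal.ofReal C * ENNReal.ofReal (2 ^ ((d : ℝ) / 2)) := by
      rw [lintegral_add_right _ hm, lintegral_const_mul' _ _ ENNReal.ofReal_ne_top,
        lintegral_const_mul' _ _ ENNReal.ofReal_ne_top, hexp, lintegral_add_left measurable_const,
        lintegral_lintegral_mehler hs hme, modular]
      simp
    _ ≤ ENNReal.ofReal C * (1 + 1) + ENNReal.ofReal C * ENNReal.ofReal (2 ^ ((d : ℝ) / 2)) := by
      gcongr
    _ = _ := by
      rw [ENNReal.ofReal_add (by positivity) (by positivity), ENNReal.ofReal_mul (by linarith),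
        ENNReal.ofReal_mul (by linarith)]
      norm_num

lemma measurable_lintegral_mehler {d : ℕ} {f : Space d → ℝ} (hf : AEMeasurable f (gaussian d))
    {Ω : Type*} [MeasurableSpace Ω] {s : Ω → ℝ} {x : Ω → Space d} (hs : Measurable s)
    (hx : Measurable x) : Measurable fun ω =>
      ∫⁻ y, ENNReal.ofReal (mehler (s ω) (x ω) y) * ‖f y‖ₑ ∂(gaussian d) := by
  have h : ∀ ω, ∫⁻ y, ENNReal.ofReal (mehler (s ω) (x ω) y) * ‖f y‖ₑ ∂(gaussian d)
      = ∫⁻ y, ENNReal.ofReal (mehler (s ω) (x ω) y) * ‖hf.mk f y‖ₑ ∂(gaussian d) := by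
    intro ω
    refine lintegral_congr_ae ?_
    filter_upwards [hf.ae_eq_mk] with y hy
    rw [hy]
  simp_rw [h]
  have hmk := hf.measurable_mk
  have hm1 : Measurable fun z : Ω × Space d => mehler (s z.1) (x z.1) z.2 :=
    measurable_mehler (by fun_prop) (by fun_prop) (by fun_prop)
  have hm : Measurable fun z : Ω × Space d =>
      ENNReal.ofReal (mehler (s z.1) (x z.1) z.2) * ‖hf.mk f z.2‖ₑ := by fun_prop
  exact hm.lintegral_prod_right'

/-- The Poisson-Hermite semigroup is bounded on `L^{p(·)}(γ_d)`, uniformly in time. -/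
lemma exists_lintegral_poisson_rpow_le {d : ℕ} {p : Space d → ℝ} (hp : GaussianDecay p)
    (hLH : LocallyLogHolder p) :
    ∃ C : ℝ, 1 ≤ C ∧ ∀ t, 0 < t → ∀ f : Space d → ℝ, AEMeasurable f (gaussian d) →
      modular p f ≤ 1 →
      ∫⁻ x, (∫⁻ s in Set.Ioi (0 : ℝ), ENNReal.ofReal (levy 0 t s) *
        ∫⁻ y, ENNReal.ofReal (mehler s x y) * ‖f y‖ₑ ∂(gaussian d)) ^ p x ∂(gaussian d)
        ≤ ENNReal.ofReal C := by
  obtain ⟨C, hC1, h⟩ := exists_lintegral_ou_rpow_le hp hLH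
  refine ⟨C, hC1, fun t ht f hf hmod => ?_⟩
  have hm : Measurable fun w : Space d × ℝ =>
      ∫⁻ y, ENNReal.ofReal (mehler w.2 w.1 y) * ‖f y‖ₑ ∂(gaussian d) :=
    measurable_lintegral_mehler hf (by fun_prop) (by fun_prop)
  have hm' : ∀ x, Measurable fun s : ℝ =>
      ∫⁻ y, ENNReal.ofReal (mehler s x y) * ‖f y‖ₑ ∂(gaussian d) := fun x =>
    measurable_lintegral_mehler hf (by fun_prop) (by fun_prop)
  have hl : Measurable fun w : Space d × ℝ => ENNReal.ofReal (levy 0 t w.2) := by fun_prop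
  calc _ ≤ ∫⁻ x, (∫⁻ s in Set.Ioi (0 : ℝ), ENNReal.ofReal (levy 0 t s) *
        (∫⁻ y, ENNReal.ofReal (mehler s x y) * ‖f y‖ₑ ∂(gaussian d)) ^ p x) ∂(gaussian d) :=
        lintegral_mono fun x => lintegral_mul_rpow_le (by fun_prop) (lintegral_levy ht) (hm' x)
          (hp.1.one_le x)
    _ = ∫⁻ s in Set.Ioi (0 : ℝ), ∫⁻ x, ENNReal.ofReal (levy 0 t s) *
        (∫⁻ y, ENNReal.ofReal (mehler s x y) * ‖f y‖ₑ ∂(gaussian d)) ^ p x ∂(gaussian d) :=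
        lintegral_lintegral_swap
          (hl.aemeasurable.mul (hm.aemeasurable.pow hp.1.aemeasurable.comp_fst))
    _ ≤ ∫⁻ s in Set.Ioi (0 : ℝ), ENNReal.ofReal (levy 0 t s) * ENNReal.ofReal C := by
        refine setLIntegral_mono' measurableSet_Ioi fun s hs => ?_
        rw [lintegral_const_mul' _ _ ENNReal.ofReal_ne_top]
        exact mul_le_mul' le_rfl (h s hs f hf hmod)
    _ = _ := by
        rw [lintegral_mul_const _ (by fun_prop), lintegral_levy ht, one_mul]

/-! ### The Luxemburg norm -/

lemma modular_eq_lintegral_enorm {d : ℕ} {p : Space d → ℝ} (hp : IsExponent p) (f : Space d → ℝ) :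
    modular p f = ∫⁻ x, ‖f x‖ₑ ^ p x ∂(gaussian d) := by
  refine lintegral_congr fun x => ?_
  rw [Real.enorm_eq_ofReal_abs, ENNReal.ofReal_rpow_of_nonneg (abs_nonneg _)
    (by linarith [hp.one_le x])]

lemma modular_div_le_one_of_lt {d : ℕ} {p : Space d → ℝ} (hp : IsExponent p) {f : Space d → ℝ}
    {B : ℝ} (h : luxemburgNorm p f < ENNReal.ofReal B) : modular p (fun x => f x / B) ≤ 1 := by
  obtain ⟨r, ⟨s, hs, rfl, hs1⟩, hsB⟩ := sInf_lt_iff.mp h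
  have hsB' : s < B := (ENNReal.ofReal_lt_ofReal_iff_of_nonneg hs.le).mp hsB
  refine le_trans (lintegral_mono fun x => ENNReal.ofReal_le_ofReal ?_) hs1
  have := hp.one_le x
  have hB0 : 0 < B := hs.trans hsB'
  rw [abs_div, abs_div, abs_of_pos hs, abs_of_pos hB0]
  gcongr

lemma luxemburgNorm_le_of_modular {d : ℕ} {p : Space d → ℝ} {f : Space d → ℝ} {B : ℝ} (hB : 0 < B)
    (h : modular p (fun x => f x / B) ≤ 1) : luxemburgNorm p f ≤ ENNReal.ofReal B :=
  sInf_le ⟨B, hB, rfl, h⟩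

lemma luxemburgNorm_le_of_enorm_le {d : ℕ} {p : Space d → ℝ} (hp : IsExponent p) {g : Space d → ℝ}
    {F : Space d → ℝ≥0∞} {c C : ℝ} (hc : 0 < c) (hC : 1 ≤ C)
    (h : ∀ x, ‖g x‖ₑ ≤ ENNReal.ofReal c * F x)
    (hF : ∫⁻ x, F x ^ p x ∂(gaussian d) ≤ ENNReal.ofReal C) :
    luxemburgNorm p g ≤ ENNReal.ofReal (c * C) := by
  have hC0 : 0 < C := by linarith
  refine luxemburgNorm_le_of_modular (by positivity) ?_
  rw [modular_eq_lintegral_enorm hp]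
  calc _ ≤ ∫⁻ x, ENNReal.ofReal C⁻¹ * F x ^ p x ∂(gaussian d) := by
        refine lintegral_mono fun x => ?_
        have hp1 := hp.one_le x
        have h1 : ‖g x / (c * C)‖ₑ ≤ ENNReal.ofReal C⁻¹ * F x := by
          rw [div_eq_mul_inv, enorm_mul, Real.enorm_of_nonneg (r := (c * C)⁻¹) (by positivity),
            mul_comm]
          calc _ ≤ ENNReal.ofReal (c * C)⁻¹ * (ENNReal.ofReal c * F x) := by
                gcongr; exact h x
            _ = _ := by
              rw [← mul_assoc, ← ENNReal.ofReal_mul (by positivity)]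
              congr 2
              field_simp
        calc _ ≤ (ENNReal.ofReal C⁻¹ * F x) ^ p x := by gcongr
          _ = ENNReal.ofReal C⁻¹ ^ p x * F x ^ p x :=
            ENNReal.mul_rpow_of_nonneg _ _ (by linarith)
          _ ≤ ENNReal.ofReal C⁻¹ ^ (1 : ℝ) * F x ^ p x := by
            gcongr ?_ * _
            refine ENNReal.rpow_le_rpow_of_exponent_ge ?_ hp1
            rw [← ENNReal.ofReal_one]
            exact ENNReal.ofReal_le_ofReal (inv_le_one_of_one_le₀ hC)
          _ = _ := by rw [ENNReal.rpow_one]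
    _ ≤ ENNReal.ofReal C⁻¹ * ENNReal.ofReal C := by
        rw [lintegral_const_mul' _ _ ENNReal.ofReal_ne_top]
        exact mul_le_mul' le_rfl hF
    _ = 1 := by
        rw [← ENNReal.ofReal_mul (by positivity), inv_mul_cancel₀ hC0.ne', ENNReal.ofReal_one]

lemma MemVarLp.integrable {d : ℕ} {p f : Space d → ℝ} (hp : IsExponent p) (hf : MemVarLp p f) :
    Integrable f (gaussian d) := by
  obtain ⟨hm, s, hs, hfin⟩ := hf
  have hfs : Integrable (fun x => f x / s) (gaussian d) := by
    refine ⟨(hm.div_const s).aestronglyMeasurable, ?_⟩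
    rw [hasFiniteIntegral_def]
    calc _ ≤ ∫⁻ x, (1 + ENNReal.ofReal (|f x / s| ^ p x)) ∂(gaussian d) := by
          refine lintegral_mono fun x => ?_
          rw [Real.enorm_eq_ofReal_abs, ← ENNReal.ofReal_one,
            ← ENNReal.ofReal_add zero_le_one (by positivity)]
          exact ENNReal.ofReal_le_ofReal (le_one_add_rpow (abs_nonneg _) (hp.one_le x))
      _ = 1 + modular p (fun x => f x / s) := by
          rw [lintegral_add_left measurable_const, modular]; simp
      _ < ∞ := ENNReal.add_lt_top.mpr ⟨ENNReal.one_lt_top, hfin⟩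
  refine (hfs.const_mul s).congr (Filter.Eventually.of_forall fun x => ?_)
  simp only
  field_simp

lemma le_mul_of_forall_lt {x y : ℝ≥0∞} (hy0 : y ≠ 0) (hy : y ≠ ∞) {A : ℝ≥0}
    (h : ∀ A' : ℝ≥0, A < A' → x ≤ A' * y) : x ≤ A * y := by
  rw [← ENNReal.div_le_iff hy0 hy]
  refine le_of_forall_gt_imp_ge_of_dense fun a ha => ?_
  induction a with
  | top => exact le_top
  | coe a => exact (ENNReal.div_le_iff hy0 hy).mpr (h a (by exact_mod_cast ha))

lemma ofReal_rpow_ne_zero {t : ℝ} (ht : 0 < t) (e : ℝ) : ENNReal.ofReal (t ^ e) ≠ 0 := by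
  simpa using Real.rpow_pos_of_pos ht e

/-- An admissible constant can be checked up to an arbitrarily small increase. -/
lemma mem_admissibleConstants_of_forall_lt {d : ℕ} {p f : Space d → ℝ} {α : ℝ} {k : ℕ} {A D : ℝ≥0}
    (h : ∀ A' : ℝ≥0, A < A' → D * A' ∈ admissibleConstants p α k f) :
    D * A ∈ admissibleConstants p α k f := by
  intro t ht
  have hy0 := ofReal_rpow_ne_zero ht (-(k : ℝ) + α)
  by_cases hD : D = 0
  · subst hD
    have := h (A + 1) (by simp) t ht
    simpa using this
  · rw [ENNReal.coe_mul, mul_comm (D : ℝ≥0∞), mul_assoc]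
    refine le_mul_of_forall_lt (mul_ne_zero (by exact_mod_cast hD) hy0)
      (ENNReal.mul_ne_top ENNReal.coe_ne_top ENNReal.ofReal_ne_top) fun A' hA' => ?_
    have := h A' hA' t ht
    rwa [ENNReal.coe_mul, mul_comm (D : ℝ≥0∞), mul_assoc] at this

lemma exists_isLeast_admissibleConstants {d : ℕ} {p f : Space d → ℝ} {α : ℝ} {k : ℕ}
    (h : (admissibleConstants p α k f).Nonempty) :
    ∃ A, IsLeast (admissibleConstants p α k f) A := by
  refine ⟨sInf (admissibleConstants p α k f), ?_, fun A hA => csInf_le' hA⟩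
  rw [← one_mul (sInf _)]
  refine mem_admissibleConstants_of_forall_lt fun A' hA' t ht => ?_
  obtain ⟨A, hA, hlt⟩ := exists_lt_of_csInf_lt h hA'
  rw [one_mul]
  refine (hA t ht).trans ?_
  gcongr

/-- A strict increase of an admissible constant turns the norm bound into a modular bound. -/
lemma modular_le_one_of_mem {d : ℕ} {p f : Space d → ℝ} (hp : IsExponent p) {α : ℝ} {k : ℕ}
    {A A' : ℝ≥0} (hA : A ∈ admissibleConstants p α k f) (hAA' : A < A') {t : ℝ} (ht : 0 < t) :
    modular p (fun x => poissonDeriv k t f x / (A' * t ^ (-(k : ℝ) + α))) ≤ 1 := by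
  refine modular_div_le_one_of_lt hp ((hA t ht).trans_lt ?_)
  rw [ENNReal.ofReal_mul (by positivity), ENNReal.ofReal_coe_nnreal]
  exact ENNReal.mul_lt_mul_left (ofReal_rpow_ne_zero ht _) ENNReal.ofReal_ne_top
    (by exact_mod_cast hAA')

/-! ### Passing between orders -/

lemma lintegral_rpow_weight {t β : ℝ} (ht : 0 < t) (hβ : 0 < β) :
    ∫⁻ s in Set.Ioi t, ENNReal.ofReal (β * t ^ β * s ^ (-β - 1)) = 1 := by
  have hI := (integrableOn_Ioi_rpow_of_lt (show -β - 1 < -1 by linarith) ht).const_mul (β * t ^ β)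
  rw [← ofReal_integral_eq_lintegral_ofReal hI, integral_const_mul,
    integral_Ioi_rpow_of_lt (by linarith) ht, ← ENNReal.ofReal_one]
  · congr 1
    have e : -β - 1 + 1 = -β := by ring
    rw [e, Real.rpow_neg ht.le]
    have : t ^ β ≠ 0 := by positivity
    field_simp
  · filter_upwards [ae_restrict_mem measurableSet_Ioi] with s hs
    have : 0 < s := ht.trans hs
    positivity

/-- Lowering the order by one: integrate in time and apply the integral Minkowski inequality, in
the form of Jensen's inequality for the modular. The constant does not depend on the exponent. -/
lemma admissible_of_succ {d : ℕ} {p f : Space d → ℝ} (hp : IsExponent p)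
    (hf : Integrable f (gaussian d)) {α : ℝ} {n : ℕ} (hn : 1 ≤ n) (hαn : α < n) {A : ℝ≥0}
    (hA : A ∈ admissibleConstants p α (n + 1) f) :
    Real.toNNReal (1 / (n - α)) * A ∈ admissibleConstants p α n f := by
  refine mem_admissibleConstants_of_forall_lt fun A' hAA' t ht => ?_
  set β := (n : ℝ) - α with hβ
  have hβ0 : 0 < β := by linarith
  have hA'0 : (0 : ℝ) < A' := by exact_mod_cast zero_le.trans_lt hAA'
  set b : ℝ → ℝ := fun s => A' * s ^ (-((n + 1 : ℕ) : ℝ) + α) with hb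
  have hb0 : ∀ s, 0 < s → 0 < b s := fun s hs => by positivity
  -- `w` is the probability density on `(t, ∞)` proportional to the bound of order `n + 1`.
  set w : ℝ → ℝ≥0∞ := fun s => ENNReal.ofReal (β * t ^ β * s ^ (-β - 1)) with hw
  -- The integral formula is used for the derivative because it is jointly measurable.
  set F : ℝ → Space d → ℝ≥0∞ := fun s x =>
    ‖(∫ u in Set.Ioi (0 : ℝ), levy (n + 1) s u * ornsteinUhlenbeck u f x) / b s‖ₑ with hF
  have hFm : Measurable fun q : Space d × ℝ => F q.2 q.1 := by
    have h1 : Measurable fun q : Space d × ℝ =>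
        ∫ u in Set.Ioi (0 : ℝ), levy (n + 1) q.2 u * ornsteinUhlenbeck u f q.1 :=
      measurable_integral_levy_mul_ou hf.aestronglyMeasurable (n + 1) (by fun_prop) (by fun_prop)
    have h2 : Measurable fun q : Space d × ℝ => b q.2 := by fun_prop
    exact (h1.div h2).enorm
  have hFm' : ∀ x, Measurable fun s => F s x := fun x => by
    have h1 : Measurable fun s : ℝ =>
        ∫ u in Set.Ioi (0 : ℝ), levy (n + 1) s u * ornsteinUhlenbeck u f x :=
      measurable_integral_levy_mul_ou hf.aestronglyMeasurable (n + 1) (by fun_prop) (by fun_prop)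
    have h2 : Measurable b := by fun_prop
    exact (h1.div h2).enorm
  have hwm : Measurable w := by fun_prop
  have hw1 : ∫⁻ s in Set.Ioi t, w s = 1 := lintegral_rpow_weight ht hβ0
  have hFs : ∀ s, 0 < s → ∫⁻ x, F s x ^ p x ∂(gaussian d) ≤ 1 := by
    intro s hs
    have h1 := modular_le_one_of_mem hp hA hAA' hs
    rw [modular_eq_lintegral_enorm hp] at h1
    refine le_of_eq_of_le (lintegral_congr fun x => ?_) h1
    rw [poissonDeriv_eq hf _ hs]
  have hpt : ∀ x, ‖poissonDeriv n t f x‖ₑ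
      ≤ ENNReal.ofReal (A' * t ^ (-β) / β) * ∫⁻ s in Set.Ioi t, w s * F s x := by
    intro x
    rw [← lintegral_const_mul' _ _ ENNReal.ofReal_ne_top]
    refine (enorm_poissonDeriv_le_lintegral hf hn ht x).trans_eq
      (setLIntegral_congr_fun measurableSet_Ioi fun s hs => ?_)
    have hs : 0 < s := ht.trans hs
    have hbs : A' * t ^ (-β) / β * (β * t ^ β * s ^ (-β - 1)) = b s := by
      have e : -((n + 1 : ℕ) : ℝ) + α = -β - 1 := by rw [hβ]; push_cast; ring
      simp only [hb]
      rw [e, Real.rpow_neg ht.le]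
      have : t ^ β ≠ 0 := by positivity
      field_simp
    simp only [hw, hF]
    rw [← mul_assoc, ← ENNReal.ofReal_mul (by positivity), hbs,
      ← Real.enorm_of_nonneg (hb0 s hs).le, ← enorm_mul, poissonDeriv_eq hf _ hs,
      mul_div_cancel₀ _ (hb0 s hs).ne']
  have hint : ∫⁻ x, (∫⁻ s in Set.Ioi t, w s * F s x) ^ p x ∂(gaussian d) ≤ ENNReal.ofReal 1 := by
    have hwm' : Measurable fun q : Space d × ℝ => w q.2 := hwm.comp measurable_snd
    calc _ ≤ ∫⁻ x, (∫⁻ s in Set.Ioi t, w s * F s x ^ p x) ∂(gaussian d) :=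
          lintegral_mono fun x => lintegral_mul_rpow_le hwm hw1 (hFm' x) (hp.one_le x)
      _ = ∫⁻ s in Set.Ioi t, ∫⁻ x, w s * F s x ^ p x ∂(gaussian d) :=
          lintegral_lintegral_swap
            (hwm'.aemeasurable.mul (hFm.aemeasurable.pow hp.aemeasurable.comp_fst))
      _ ≤ ∫⁻ s in Set.Ioi t, w s := by
          refine setLIntegral_mono' measurableSet_Ioi fun s hs => ?_
          rw [lintegral_const_mul' _ _ ENNReal.ofReal_ne_top]
          exact mul_le_of_le_one_right' (hFs s (ht.trans hs))
      _ = _ := by rw [hw1, ENNReal.ofReal_one]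
  refine (luxemburgNorm_le_of_enorm_le hp (by positivity) le_rfl hpt hint).trans_eq ?_
  rw [ENNReal.coe_mul, ← ENNReal.ofReal_coe_nnreal, ← ENNReal.ofReal_coe_nnreal,
    Real.coe_toNNReal _ (by positivity), ← ENNReal.ofReal_mul (by positivity),
    ← ENNReal.ofReal_mul (by positivity)]
  congr 1
  rw [show -(n : ℝ) + α = -β by rw [hβ]; ring]
  ring

/-- Lowering the order, with a constant that depends only on the orders and on `α`. -/
lemma exists_admissible_of_le (α : ℝ) {l k : ℕ} (hl : 1 ≤ l) (hαl : α < l) (hlk : l ≤ k) :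
    ∃ D : ℝ≥0, 0 < D ∧ ∀ (d : ℕ) (p f : Space d → ℝ), IsExponent p → MemVarLp p f →
      ∀ A ∈ admissibleConstants p α k f, D * A ∈ admissibleConstants p α l f := by
  induction k, hlk using Nat.le_induction with
  | base => exact ⟨1, one_pos, fun d p f _ _ A hA => by rwa [one_mul]⟩
  | succ k hlk ih =>
    obtain ⟨D, hD, h⟩ := ih
    have hαk : α < k := hαl.trans_le (by exact_mod_cast hlk)
    refine ⟨D * Real.toNNReal (1 / (k - α)), mul_pos hD ?_, fun d p f hp hf A hA => ?_⟩
    · rw [Real.toNNReal_pos]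
      exact one_div_pos.mpr (by linarith)
    · rw [mul_assoc]
      exact h d p f hp hf _ (admissible_of_succ hp (hf.integrable hp) (hl.trans hlk) hαk hA)

/-- Raising the order: half of the time is used for the given bound, the other half for the
smoothing of the semigroup, which is bounded on `L^{p(·)}(γ_d)`. -/
lemma exists_admissible_add {d : ℕ} {p : Space d → ℝ} (hp : GaussianDecay p)
    (hLH : LocallyLogHolder p) (α : ℝ) (j k : ℕ) :
    ∃ C : ℝ≥0, 0 < C ∧ ∀ f : Space d → ℝ, MemVarLp p f →
      ∀ A ∈ admissibleConstants p α k f, C * A ∈ admissibleConstants p α (j + k) f := by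
  obtain ⟨C₁, hC₁, h₁⟩ := exists_enorm_poissonDeriv_le j
  obtain ⟨C₂, hC₂, h₂⟩ := exists_lintegral_poisson_rpow_le hp hLH
  have hC₂0 : 0 < C₂ := by linarith
  have hc0 : 0 < C₁ * C₂ * (1 / 2 : ℝ) ^ (-((j + k : ℕ) : ℝ) + α) := by positivity
  refine ⟨Real.toNNReal (C₁ * C₂ * (1 / 2 : ℝ) ^ (-((j + k : ℕ) : ℝ) + α)),
    Real.toNNReal_pos.mpr hc0,
    fun f hf A hA => mem_admissibleConstants_of_forall_lt fun A' hAA' t ht => ?_⟩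
  have hfi := hf.integrable hp.1
  have hA'0 : (0 : ℝ) < A' := by exact_mod_cast zero_le.trans_lt hAA'
  have hb0 : 0 < t / 2 := half_pos ht
  have hmod := modular_le_one_of_mem hp.1 hA hAA' hb0
  set B := (A' : ℝ) * (t / 2) ^ (-(k : ℝ) + α) with hB
  have hB0 : 0 < B := by positivity
  have hgi := integrable_poissonDeriv hfi k hb0
  have hint := h₂ (t / 2 / 2) (half_pos hb0) _ (hgi.aestronglyMeasurable.aemeasurable.div_const B)
    hmod
  have hpt : ∀ x, ‖poissonDeriv (j + k) t f x‖ₑ ≤ ENNReal.ofReal (C₁ / (t / 2) ^ j * B) *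
      ∫⁻ s in Set.Ioi (0 : ℝ), ENNReal.ofReal (levy 0 (t / 2 / 2) s) *
        ∫⁻ y, ENNReal.ofReal (mehler s x y) * ‖poissonDeriv k (t / 2) f y / B‖ₑ
          ∂(gaussian d) := by
    intro x
    have e := poissonDeriv_poissonDeriv hfi j k hb0 hb0 x
    rw [add_halves] at e
    rw [← e, ENNReal.ofReal_mul (by positivity), mul_assoc]
    refine (h₁ d _ hgi (t / 2) hb0 x).trans_eq ?_
    congr 1
    rw [← lintegral_const_mul' _ _ ENNReal.ofReal_ne_top]
    refine lintegral_congr fun s => ?_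
    rw [mul_left_comm]
    congr 1
    rw [← lintegral_const_mul' _ _ ENNReal.ofReal_ne_top]
    refine lintegral_congr fun y => ?_
    rw [mul_left_comm, ← Real.enorm_of_nonneg hB0.le, ← enorm_mul, mul_div_cancel₀ _ hB0.ne']
  refine (luxemburgNorm_le_of_enorm_le hp.1 (by positivity) hC₂ hpt hint).trans_eq ?_
  rw [ENNReal.coe_mul, ← ENNReal.ofReal_coe_nnreal, ← ENNReal.ofReal_coe_nnreal,
    Real.coe_toNNReal _ hc0.le, ← ENNReal.ofReal_mul (by positivity),
    ← ENNReal.ofReal_mul (by positivity)]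
  congr 1
  have e1 : (1 / 2 : ℝ) ^ (-((j + k : ℕ) : ℝ) + α) * t ^ (-((j + k : ℕ) : ℝ) + α)
      = (t / 2) ^ (-((j + k : ℕ) : ℝ) + α) := by
    rw [← Real.mul_rpow (by norm_num) ht.le]
    congr 1
    ring
  have e2 : (t / 2) ^ (-((j + k : ℕ) : ℝ) + α) = (t / 2) ^ (-(k : ℝ) + α) / (t / 2) ^ j := by
    rw [← Real.rpow_natCast (t / 2) j, ← Real.rpow_sub hb0]
    congr 1
    push_cast
    ring
  calc _ = C₁ * C₂ * A' * ((t / 2) ^ (-(k : ℝ) + α) / (t / 2) ^ j) := by rw [hB]; ring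
    _ = C₁ * C₂ * A' * ((1 / 2 : ℝ) ^ (-((j + k : ℕ) : ℝ) + α) *
          t ^ (-((j + k : ℕ) : ℝ) + α)) := by rw [e1, e2]
    _ = _ := by ring

/-- Two orders above `α` have comparable admissible constants. -/
lemma exists_admissible_transfer {d : ℕ} {p : Space d → ℝ} (hp : GaussianDecay p)
    (hLH : LocallyLogHolder p) {α : ℝ} (hα : 0 ≤ α) (k l : ℕ) (hl : α < l) :
    ∃ C : ℝ≥0, 0 < C ∧ ∀ f : Space d → ℝ, MemVarLp p f →
      ∀ A ∈ admissibleConstants p α k f, C * A ∈ admissibleConstants p α l f := by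
  rcases le_total l k with hlk | hkl
  · have hl1 : 1 ≤ l := by
      have : (0 : ℝ) < l := hα.trans_lt hl
      exact_mod_cast this
    obtain ⟨D, hD, h⟩ := exists_admissible_of_le α hl1 hl hlk
    exact ⟨D, hD, fun f hf => h d p f hp.1 hf⟩
  · obtain ⟨j, rfl⟩ := Nat.exists_eq_add_of_le' hkl
    exact exists_admissible_add hp hLH α j k

lemma besovInftyOfOrder_eq_besovInfty {d : ℕ} {p : Space d → ℝ} (hp : GaussianDecay p)
    (hLH : LocallyLogHolder p) {α : ℝ} (hα : 0 ≤ α) {k : ℕ} (hk : α < k) :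
    besovInftyOfOrder p α k = besovInfty p α := by
  obtain ⟨C, -, h⟩ := exists_admissible_transfer hp hLH hα (⌊α⌋₊ + 1) k hk
  obtain ⟨C', -, h'⟩ := exists_admissible_transfer hp hLH hα k (⌊α⌋₊ + 1)
    (by exact_mod_cast Nat.lt_floor_add_one α)
  ext f
  exact ⟨fun ⟨hf, A, hA⟩ => ⟨hf, _, h' f hf A hA⟩, fun ⟨hf, A, hA⟩ => ⟨hf, _, h f hf A hA⟩⟩

end GaussianBesov

end

theorem mainTheorem6 (α : ℝ) (hα : 0 ≤ α) (k l : ℕ) (hk : α < k) (hl : α < l) :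
    ∃ D : ℝ≥0, 0 < D ∧
      ∀ (d : ℕ) (p : GaussianBesov.Space d → ℝ),
        GaussianBesov.GaussianDecay p → GaussianBesov.LocallyLogHolder p →
        (∃ c C : ℝ≥0, 0 < c ∧ 0 < C ∧
          ∀ f : GaussianBesov.Space d → ℝ, GaussianBesov.MemVarLp p f →
            ((GaussianBesov.admissibleConstants p α k f).Nonempty ↔
              (GaussianBesov.admissibleConstants p α l f).Nonempty) ∧
            ((GaussianBesov.admissibleConstants p α k f).Nonempty →
              ∃ Ak Al : ℝ≥0,
                IsLeast (GaussianBesov.admissibleConstants p α k f) Ak ∧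
                IsLeast (GaussianBesov.admissibleConstants p α l f) Al ∧
                c * Ak ≤ Al ∧ Al ≤ C * Ak ∧ (l ≤ k → Al ≤ D * Ak))) ∧
        GaussianBesov.besovInftyOfOrder p α k = GaussianBesov.besovInfty p α ∧
        GaussianBesov.besovInftyOfOrder p α l = GaussianBesov.besovInfty p α := by
  have hl1 : 1 ≤ l := by
    have : (0 : ℝ) < l := hα.trans_lt hl
    exact_mod_cast this
  obtain ⟨D, hD, hDl⟩ : ∃ D : ℝ≥0, 0 < D ∧ (l ≤ k → ∀ (d : ℕ) (p f : GaussianBesov.Space d → ℝ),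
      GaussianBesov.IsExponent p → GaussianBesov.MemVarLp p f →
      ∀ A ∈ GaussianBesov.admissibleConstants p α k f,
        D * A ∈ GaussianBesov.admissibleConstants p α l f) := by
    by_cases hlk : l ≤ k
    · obtain ⟨D, hD, h⟩ := GaussianBesov.exists_admissible_of_le α hl1 hl hlk
      exact ⟨D, hD, fun _ => h⟩
    · exact ⟨1, one_pos, fun h => absurd h hlk⟩
  refine ⟨D, hD, fun d p hp hLH => ⟨?_,
    GaussianBesov.besovInftyOfOrder_eq_besovInfty hp hLH hα hk,
    GaussianBesov.besovInftyOfOrder_eq_besovInfty hp hLH hα hl⟩⟩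
  obtain ⟨C, hC, hkl⟩ := GaussianBesov.exists_admissible_transfer hp hLH hα k l hl
  obtain ⟨C', hC', hlk⟩ := GaussianBesov.exists_admissible_transfer hp hLH hα l k hk
  refine ⟨C'⁻¹, C, inv_pos.mpr hC', hC, fun f hf => ⟨⟨fun ⟨A, hA⟩ => ⟨_, hkl f hf A hA⟩,
    fun ⟨A, hA⟩ => ⟨_, hlk f hf A hA⟩⟩, fun ⟨A, hA⟩ => ?_⟩⟩
  obtain ⟨Ak, hAk⟩ := GaussianBesov.exists_isLeast_admissibleConstants ⟨A, hA⟩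
  obtain ⟨Al, hAl⟩ := GaussianBesov.exists_isLeast_admissibleConstants ⟨_, hkl f hf A hA⟩
  refine ⟨Ak, Al, hAk, hAl, ?_, hAl.2 (hkl f hf Ak hAk.1),
    fun h => hAl.2 (hDl h d p f hp.1 hf Ak hAk.1)⟩
  rw [inv_mul_le_iff₀ hC']
  exact hAk.2 (hlk f hf Al hAl.1)
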